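/- Let $\Omega\subset\mathbb{C}^2$ be a bounded pseudoconvex domain with smooth boundary. A defining function of $\Omega$ is a real function $\rho$, $C^\infty$ on an open neighborhood $U$ of $\overline\Omega$, with $\Omega=\{p\in U:\rho(p)<0\}$, $\partial\Omega=\{p\in U:\rho(p)=0\}$ and $\nabla\rho\neq0$ on $\partial\Omega$. Let $\delta$ be an arbitrary defining function of $\Omega$. With coordinates $(z,w)=(z_1,z_2)$, put on $\partial\Omega$ $$L=\frac{1}{\sqrt{|\delta_z|^2+|\delta_w|^2}}\Big(\frac{\partial\delta}{\partial w}\frac{\partial}{\partial z}-\frac{\partial\delta}{\partial z}\frac{\partial}{\partial w}\Big),\qquad N=\frac{1}{\sqrt{|\delta_z|^2+|\delta_w|^2}}\Big(\frac{\partial\delta}{\partial\bar z}\frac{\partial}{\partial z}+\frac{\partial\delta}{\partial\bar w}\frac{\partial}{\partial w}\Big),$$ and, for $Z=\sum_j a_j\,\partial/\partial z_j$ and $W=\sum_k b_k\,\partial/\partial z_k$, let $\mathrm{Hess}_\delta(Z,W)=\sum_{j,k}a_j\overline{b_k}\,\partial^2\delta/\partial z_j\partial\bar z_k$. Pseudoconvexity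 means $\mathrm{Hess}_\delta(L,L)\ge0$ on $\partial\Omega$, and the Levi-flat set is $\Sigma=\{p\in\partial\Omega:\mathrm{Hess}_\delta(L,L)(p)=0\}$; neither depends on the choice of $\delta$. Suppose there is a real-valued function $u$, $C^\infty$ on an open neighborhood of $\Sigma$ in $\mathbb{C}^2$, such that $$L(u)=-\frac{\mathrm{Hess}_\delta(L,N)}{\|\nabla\delta\|}\quad\text{on }\Sigma,$$ where $\|\nabla\delta\|$ is the Euclidean norm of the real gradient. Then the Diederich–Fornæss index of $\Omega$ is $1$, that is, the supremum of all $\tau\in(0,1)$ for which there is a defining function $\rho$ of $\Omega$ such that $-(-\rho)^{\tau}$ is plurisubharmonic on $\Omega$ equals $1$. -/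

import Mathlib

open scoped ContDiff Gradient ComplexConjugate

noncomputable section

/-- The space `ℂ²` with its Euclidean norm; the coordinates are `z = p 0` and `w = p 1`. -/
abbrev CTwo : Type := EuclideanSpace ℂ (Fin 2)

/-- The Wirtinger derivative `∂f/∂z_j = (∂f/∂x_j - i ∂f/∂y_j) / 2`. -/
def wirtinger (j : Fin 2) (f : CTwo → ℂ) (p : CTwo) : ℂ :=
  (fderiv ℝ f p (EuclideanSpace.single j 1)
    - Complex.I * fderiv ℝ f p (EuclideanSpace.single j Complex.I)) / 2

/-- The conjugate Wirtinger derivative `∂f/∂z̄_j = (∂f/∂x_j + i ∂f/∂y_j) / 2`. -/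
def wirtingerBar (j : Fin 2) (f : CTwo → ℂ) (p : CTwo) : ℂ :=
  (fderiv ℝ f p (EuclideanSpace.single j 1)
    + Complex.I * fderiv ℝ f p (EuclideanSpace.single j Complex.I)) / 2

/-- A real function, regarded as a complex-valued one. -/
def toComplexFun (f : CTwo → ℝ) : CTwo → ℂ := fun p => (f p : ℂ)

/-- The derivative `Z f` at `p` of a real function `f` along the holomorphic tangent vector
`Z = a₀ ∂/∂z + a₁ ∂/∂w`. -/
def holDeriv (a : CTwo) (f : CTwo → ℝ) (p : CTwo) : ℂ :=
  ∑ j, a j * wirtinger j (toComplexFun f) p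

/-- The complex Hessian `Hess_f(Z, W)` at `p` on the holomorphic tangent vectors
`Z = ∑ a_j ∂/∂z_j` and `W = ∑ b_k ∂/∂z_k`, which in the flat space `ℂ²` is
`∑ a_j conj(b_k) ∂²f/∂z_j∂z̄_k`. -/
def complexHess (f : CTwo → ℝ) (p a b : CTwo) : ℂ :=
  ∑ j, ∑ k, a j * conj (b k) * wirtinger j (wirtingerBar k (toComplexFun f)) p

/-- `√(|∂ρ/∂z|² + |∂ρ/∂w|²)`. -/
def delNorm (ρ : CTwo → ℝ) (p : CTwo) : ℝ :=
  √(‖wirtinger 0 (toComplexFun ρ) p‖ ^ 2 + ‖wirtinger 1 (toComplexFun ρ) p‖ ^ 2)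

/-- The normalized holomorphic tangential vector field
`L = (∂ρ/∂w ∂/∂z - ∂ρ/∂z ∂/∂w) / √(|∂ρ/∂z|² + |∂ρ/∂w|²)`, given by its coefficients. -/
def tangentL (ρ : CTwo → ℝ) (p : CTwo) : CTwo :=
  (delNorm ρ p)⁻¹ •
    !₂[wirtinger 1 (toComplexFun ρ) p, -wirtinger 0 (toComplexFun ρ) p]

/-- The normalized complex normal vector field
`N = (∂ρ/∂z̄ ∂/∂z + ∂ρ/∂w̄ ∂/∂w) / √(|∂ρ/∂z|² + |∂ρ/∂w|²)`, given by its coefficients. -/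
def normalN (ρ : CTwo → ℝ) (p : CTwo) : CTwo :=
  (delNorm ρ p)⁻¹ •
    !₂[wirtingerBar 0 (toComplexFun ρ) p, wirtingerBar 1 (toComplexFun ρ) p]

/-- `ρ` is a (smooth) defining function of `Ω`: it is smooth on an open neighbourhood `U` of the
closure of `Ω`, in which `Ω` and `∂Ω` are the sets `ρ < 0` and `ρ = 0`, and its gradient does not
vanish on `∂Ω`. -/
def IsDefiningFunction (Ω : Set CTwo) (ρ : CTwo → ℝ) : Prop :=
  ∃ U : Set CTwo, IsOpen U ∧ closure Ω ⊆ U ∧ ContDiffOn ℝ ∞ ρ U ∧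
    Ω = {p ∈ U | ρ p < 0} ∧ frontier Ω = {p ∈ U | ρ p = 0} ∧
    ∀ p ∈ frontier Ω, ∇ ρ p ≠ 0

/-- The Levi form `Hess_ρ(L, L)` at a boundary point (a real number, as the complex Hessian of a
smooth real function is Hermitian). -/
def leviForm (ρ : CTwo → ℝ) (p : CTwo) : ℝ :=
  (complexHess ρ p (tangentL ρ p) (tangentL ρ p)).re

/-- (Levi) pseudoconvexity of a smoothly bounded `Ω ⊂ ℂ²` with defining function `ρ`: the Levi form
is nonnegative on `∂Ω`. The condition does not depend on the choice of the defining function, since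
another choice multiplies the Levi form at each boundary point by a positive number. -/
def IsLeviPseudoconvex (Ω : Set CTwo) (ρ : CTwo → ℝ) : Prop :=
  ∀ p ∈ frontier Ω, 0 ≤ leviForm ρ p

/-- The Levi-flat set `Σ ⊆ ∂Ω` of the boundary points at which the Levi form vanishes; it does not
depend on the choice of the defining function either. -/
def leviFlatSet (Ω : Set CTwo) (ρ : CTwo → ℝ) : Set CTwo :=
  {p ∈ frontier Ω | leviForm ρ p = 0}

/-- A real-valued function `v` is plurisubharmonic on `Ω`: it is upper semicontinuous and satisfies
the sub-mean value inequality on every closed complex disc `{a + ζ b : |ζ| ≤ 1}` in `Ω`. -/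
def IsPlurisubharmonicOn (v : CTwo → ℝ) (Ω : Set CTwo) : Prop :=
  UpperSemicontinuousOn v Ω ∧
    ∀ a b : CTwo, (∀ ζ : ℂ, ‖ζ‖ ≤ 1 → a + ζ • b ∈ Ω) →
      CircleIntegrable (fun ζ : ℂ => v (a + ζ • b)) 0 1 ∧
        v a ≤ Real.circleAverage (fun ζ : ℂ => v (a + ζ • b)) 0 1

/-- `τ` is a Diederich–Fornæss exponent of `Ω`: `0 < τ < 1` and `-(-ρ)^τ` is plurisubharmonic on `Ω`
for some defining function `ρ` of `Ω`. -/
def IsDFExponent (Ω : Set CTwo) (τ : ℝ) : Prop :=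
  0 < τ ∧ τ < 1 ∧ ∃ ρ : CTwo → ℝ, IsDefiningFunction Ω ρ ∧
    IsPlurisubharmonicOn (fun p => -(-ρ p) ^ τ) Ω

/-- The Diederich–Fornæss index of `Ω`, the supremum of the Diederich–Fornæss exponents (which are
bounded by `1`; if there are none, the value is `0`). -/
def dfIndex (Ω : Set CTwo) : ℝ := sSup {τ : ℝ | IsDFExponent Ω τ}

end

/-! Write T and n for the unnormalized tangential and normal fields, D for `delSq`, λ = Hess_δ(T,T)
and F = Hess_δ(n,T). For τ > 0, the function -(-r)^τ has nonnegative complex Hessian at an interior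
point exactly when Hess_r(Z,Z) + ((1-τ)/(-r))|Zr|² ≥ 0 for all Z (`HessBound`). The second term
controls the normal direction. What can fail is the tangential part near Σ: just inside ∂Ω the Levi
form may be negative of order |δ|, and there is a mixed term to absorb.

Multiplying δ by e^ψ turns F on ∂Ω into a positive multiple of F + D·conj(Tψ)
(`hessNorTan_mul_exp_of_zero`). As ‖∇δ‖ = 2√D, the equation for u says exactly that ψ = 2u makes the
mixed Hessian vanish on Σ. After this normalization, symmetry of third derivatives gives n(λ) = T(F)
on Σ (`cDeriv_norField_leviTan`). Integrating along n from the boundary, where λ ≥ 0, yields λ ≥ kδ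
inside, for any k > Re(TF)/D (`eventually_nonneg_of_boundary`).

A second factor e^φ with φ = -ε|z|² - M|F|² repairs this loss. Since F = 0 on Σ, -Hess_φ(T,T)
contains M|TF|² there, while Tφ only sees the ε-term. By AM-GM, M|TF|² plus part of the ε-term
dominates k, and ε small relative to 1-τ makes |Tφ|² harmless. Off Σ the Levi form is positive and
leaves room for any k. The criterion `eventually_hessBound` turns these inequalities at a boundary
point into the Hessian bound nearby, and compactness gives a collar.

Finally a convex truncation makes the function constant deep inside Ω while leaving the defining
function unchanged near ∂Ω (`isDFExponent_of_hessBound`). Thus every τ in (0,1) is an exponent. -/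

open Filter Topology

/-! ### Wirtinger derivatives along vectors, and their locality. -/

/-- The derivative `∑ a_j ∂f/∂z_j` of a complex-valued function. -/
noncomputable def cDeriv (a : CTwo) (f : CTwo → ℂ) (p : CTwo) : ℂ := ∑ j, a j * wirtinger j f p

/-- The derivative `∑ conj(a_j) ∂f/∂z̄_j` of a complex-valued function. -/
noncomputable def cDerivBar (a : CTwo) (f : CTwo → ℂ) (p : CTwo) : ℂ :=
  ∑ j, conj (a j) * wirtingerBar j f p

/-- The complex Hessian of a complex-valued function. -/
noncomputable def cHess (f : CTwo → ℂ) (p a b : CTwo) : ℂ :=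
  ∑ j, ∑ k, a j * conj (b k) * wirtinger j (wirtingerBar k f) p

theorem decomp (v : CTwo) : v = ∑ j : Fin 2, ((v j).re • (EuclideanSpace.single j 1 : CTwo)
    + (v j).im • (EuclideanSpace.single j Complex.I : CTwo)) := by
  ext k
  fin_cases k <;> simp [Fin.sum_univ_two, Complex.re_add_im]

theorem fderiv_eq_wirtinger (f : CTwo → ℂ) (p v : CTwo) :
    fderiv ℝ f p v = cDeriv v f p + cDerivBar v f p := by
  conv_lhs => rw [decomp v]
  simp only [map_sum, map_add, map_smul, cDeriv, cDerivBar, ← Finset.sum_add_distrib]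
  refine Finset.sum_congr rfl fun j _ => ?_
  simp only [wirtinger, wirtingerBar, Complex.real_smul]
  conv_rhs => rw [← Complex.re_add_im (v j)]
  simp only [map_add, map_mul, Complex.conj_ofReal, Complex.conj_I]
  linear_combination ((v j).im * fderiv ℝ f p (EuclideanSpace.single j Complex.I)) * Complex.I_sq

theorem cDeriv_smul (c : ℂ) (a : CTwo) (f : CTwo → ℂ) (p : CTwo) :
    cDeriv (c • a) f p = c * cDeriv a f p := by
  simp [cDeriv, Fin.sum_univ_two]; ring

theorem cDerivBar_smul (c : ℂ) (a : CTwo) (f : CTwo → ℂ) (p : CTwo) :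
    cDerivBar (c • a) f p = conj c * cDerivBar a f p := by
  simp [cDerivBar, Fin.sum_univ_two]; ring

theorem cDeriv_eq_fderiv (f : CTwo → ℂ) (p v : CTwo) :
    cDeriv v f p = (fderiv ℝ f p v - Complex.I * fderiv ℝ f p (Complex.I • v)) / 2 := by
  rw [fderiv_eq_wirtinger, fderiv_eq_wirtinger, cDeriv_smul, cDerivBar_smul, Complex.conj_I]
  linear_combination (cDeriv v f p / 2 - cDerivBar v f p / 2) * Complex.I_sq

theorem cDerivBar_eq_fderiv (f : CTwo → ℂ) (p v : CTwo) :
    cDerivBar v f p = (fderiv ℝ f p v + Complex.I * fderiv ℝ f p (Complex.I • v)) / 2 := by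
  rw [fderiv_eq_wirtinger, fderiv_eq_wirtinger, cDeriv_smul, cDerivBar_smul, Complex.conj_I]
  linear_combination (-cDeriv v f p / 2 + cDerivBar v f p / 2) * Complex.I_sq

section germ

variable {f g : CTwo → ℂ} {p : CTwo}

theorem wirtinger_congr (h : f =ᶠ[𝓝 p] g) (j : Fin 2) : wirtinger j f p = wirtinger j g p := by
  simp only [wirtinger, h.fderiv_eq]

theorem wirtingerBar_congr (h : f =ᶠ[𝓝 p] g) (j : Fin 2) :
    wirtingerBar j f p = wirtingerBar j g p := by
  simp only [wirtingerBar, h.fderiv_eq]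

theorem wirtingerBar_eventuallyEq (h : f =ᶠ[𝓝 p] g) (j : Fin 2) :
    wirtingerBar j f =ᶠ[𝓝 p] wirtingerBar j g :=
  (eventually_eventually_nhds.2 h).mono fun _ hq => wirtingerBar_congr hq j

theorem cHess_congr (h : f =ᶠ[𝓝 p] g) (a b : CTwo) : cHess f p a b = cHess g p a b := by
  simp only [cHess, wirtinger_congr (wirtingerBar_eventuallyEq h _)]

theorem cDeriv_congr (h : f =ᶠ[𝓝 p] g) (a : CTwo) : cDeriv a f p = cDeriv a g p := by
  simp only [cDeriv, wirtinger_congr h]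

end germ

/-! ### Sum, product, conjugation and symmetry rules. -/

section calculus

variable {f g : CTwo → ℂ} {p : CTwo}

theorem wirtinger_add (hf : DifferentiableAt ℝ f p) (hg : DifferentiableAt ℝ g p) (j : Fin 2) :
    wirtinger j (fun q => f q + g q) p = wirtinger j f p + wirtinger j g p := by
  simp only [wirtinger, fderiv_fun_add hf hg, add_apply]; ring

theorem wirtingerBar_add (hf : DifferentiableAt ℝ f p) (hg : DifferentiableAt ℝ g p) (j : Fin 2) :
    wirtingerBar j (fun q => f q + g q) p = wirtingerBar j f p + wirtingerBar j g p := by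
  simp only [wirtingerBar, fderiv_fun_add hf hg, add_apply]; ring

theorem wirtinger_neg (j : Fin 2) :
    wirtinger j (fun q => -f q) p = -wirtinger j f p := by
  simp only [wirtinger, fderiv_fun_neg, neg_apply]; ring

theorem wirtinger_mul (hf : DifferentiableAt ℝ f p) (hg : DifferentiableAt ℝ g p) (j : Fin 2) :
    wirtinger j (fun q => f q * g q) p = f p * wirtinger j g p + g p * wirtinger j f p := by
  simp only [wirtinger, fderiv_fun_mul hf hg, add_apply,
    smul_apply, smul_eq_mul]; ring

theorem wirtingerBar_mul (hf : DifferentiableAt ℝ f p) (hg : DifferentiableAt ℝ g p)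
    (j : Fin 2) :
    wirtingerBar j (fun q => f q * g q) p
      = f p * wirtingerBar j g p + g p * wirtingerBar j f p := by
  simp only [wirtingerBar, fderiv_fun_mul hf hg, add_apply,
    smul_apply, smul_eq_mul]; ring

theorem wirtinger_const (c : ℂ) (j : Fin 2) : wirtinger j (fun _ => c) p = 0 := by
  simp [wirtinger]

theorem wirtingerBar_const (c : ℂ) (j : Fin 2) : wirtingerBar j (fun _ => c) p = 0 := by
  simp [wirtingerBar]

theorem fderiv_conj_comp (hf : DifferentiableAt ℝ f p) (v : CTwo) :
    fderiv ℝ (fun q => conj (f q)) p v = conj (fderiv ℝ f p v) := by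
  have := (Complex.conjCLE.toContinuousLinearMap.hasFDerivAt (x := f p)).comp p hf.hasFDerivAt
  have h2 : HasFDerivAt (fun q => conj (f q)) _ p := this
  rw [h2.fderiv]; simp

theorem wirtinger_conj (hf : DifferentiableAt ℝ f p) (j : Fin 2) :
    wirtinger j (fun q => conj (f q)) p = conj (wirtingerBar j f p) := by
  simp only [wirtinger, wirtingerBar, fderiv_conj_comp hf]
  simp [map_ofNat]; ring

theorem wirtingerBar_conj (hf : DifferentiableAt ℝ f p) (j : Fin 2) :
    wirtingerBar j (fun q => conj (f q)) p = conj (wirtinger j f p) := by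
  simp only [wirtinger, wirtingerBar, fderiv_conj_comp hf]
  simp [map_ofNat]

theorem contDiffAt_wirtinger {n m : ℕ∞} (hf : ContDiffAt ℝ n f p) (h : m + 1 ≤ n) (j : Fin 2) :
    ContDiffAt ℝ m (wirtinger j f) p := by
  have : ContDiffAt ℝ m (fderiv ℝ f) p := hf.fderiv_right (by exact_mod_cast h)
  unfold wirtinger
  fun_prop

theorem contDiffAt_wirtingerBar {n m : ℕ∞} (hf : ContDiffAt ℝ n f p) (h : m + 1 ≤ n)
    (j : Fin 2) : ContDiffAt ℝ m (wirtingerBar j f) p := by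
  have : ContDiffAt ℝ m (fderiv ℝ f) p := hf.fderiv_right (by exact_mod_cast h)
  unfold wirtingerBar
  fun_prop

theorem contDiff_wirtinger (hf : ContDiff ℝ ∞ f) (j : Fin 2) : ContDiff ℝ ∞ (wirtinger j f) :=
  contDiff_iff_contDiffAt.2 fun _ => contDiffAt_wirtinger (n := ⊤) (m := ⊤) hf.contDiffAt le_top j

theorem contDiff_wirtingerBar (hf : ContDiff ℝ ∞ f) (j : Fin 2) :
    ContDiff ℝ ∞ (wirtingerBar j f) :=
  contDiff_iff_contDiffAt.2 fun _ =>
    contDiffAt_wirtingerBar (n := ⊤) (m := ⊤) hf.contDiffAt le_top j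

theorem fderiv_fderiv_comm (hf : ContDiffAt ℝ 2 f p) (a b : CTwo) :
    fderiv ℝ (fun q => fderiv ℝ f q a) p b = fderiv ℝ (fun q => fderiv ℝ f q b) p a := by
  have hd : DifferentiableAt ℝ (fderiv ℝ f) p :=
    (hf.fderiv_right (m := 1) (by norm_num)).differentiableAt (by norm_num)
  have hs := hf.isSymmSndFDerivAt (by simp)
  have key : ∀ a b : CTwo, fderiv ℝ (fun q => fderiv ℝ f q a) p b
      = fderiv ℝ (fderiv ℝ f) p b a := by
    intro a b
    rw [fderiv_clm_apply hd (differentiableAt_const a)]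
    simp
  rw [key, key]
  exact hs b a

theorem differentiableAt_fderiv_apply (hf : ContDiffAt ℝ 2 f p) (a : CTwo) :
    DifferentiableAt ℝ (fun q => fderiv ℝ f q a) p := by
  have : DifferentiableAt ℝ (fderiv ℝ f) p :=
    (hf.fderiv_right (m := 1) (by norm_num)).differentiableAt (by norm_num)
  fun_prop

theorem fderiv_wirtinger (hf : ContDiffAt ℝ 2 f p) (j : Fin 2) (v : CTwo) :
    fderiv ℝ (wirtinger j f) p v
      = (fderiv ℝ (fun q => fderiv ℝ f q (EuclideanSpace.single j 1)) p v
        - Complex.I * fderiv ℝ (fun q => fderiv ℝ f q (EuclideanSpace.single j Complex.I)) p v)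
        / 2 := by
  have h1 := (differentiableAt_fderiv_apply hf (EuclideanSpace.single j 1)).hasFDerivAt
  have h2 := (differentiableAt_fderiv_apply hf (EuclideanSpace.single j Complex.I)).hasFDerivAt
  have := ((h1.sub (h2.const_mul Complex.I)).mul_const (2⁻¹ : ℂ))
  have e : wirtinger j f = fun q => (fderiv ℝ f q (EuclideanSpace.single j 1)
    - Complex.I * fderiv ℝ f q (EuclideanSpace.single j Complex.I)) * 2⁻¹ := by
    ext q; simp only [wirtinger]; ring
  rw [e, HasFDerivAt.fderiv (f := fun q => (fderiv ℝ f q (EuclideanSpace.single j 1)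
    - Complex.I * fderiv ℝ f q (EuclideanSpace.single j Complex.I)) * 2⁻¹) this]
  simp; ring

theorem fderiv_wirtingerBar (hf : ContDiffAt ℝ 2 f p) (j : Fin 2) (v : CTwo) :
    fderiv ℝ (wirtingerBar j f) p v
      = (fderiv ℝ (fun q => fderiv ℝ f q (EuclideanSpace.single j 1)) p v
        + Complex.I * fderiv ℝ (fun q => fderiv ℝ f q (EuclideanSpace.single j Complex.I)) p v)
        / 2 := by
  have h1 := (differentiableAt_fderiv_apply hf (EuclideanSpace.single j 1)).hasFDerivAt
  have h2 := (differentiableAt_fderiv_apply hf (EuclideanSpace.single j Complex.I)).hasFDerivAt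
  have := ((h1.add (h2.const_mul Complex.I)).mul_const (2⁻¹ : ℂ))
  have e : wirtingerBar j f = fun q => (fderiv ℝ f q (EuclideanSpace.single j 1)
    + Complex.I * fderiv ℝ f q (EuclideanSpace.single j Complex.I)) * 2⁻¹ := by
    ext q; simp only [wirtingerBar]; ring
  rw [e, HasFDerivAt.fderiv (f := fun q => (fderiv ℝ f q (EuclideanSpace.single j 1)
    + Complex.I * fderiv ℝ f q (EuclideanSpace.single j Complex.I)) * 2⁻¹) this]
  simp; ring

theorem wirtinger_wirtinger_comm (hf : ContDiffAt ℝ 2 f p) (j k : Fin 2) :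
    wirtinger j (wirtinger k f) p = wirtinger k (wirtinger j f) p := by
  rw [wirtinger, wirtinger, fderiv_wirtinger hf, fderiv_wirtinger hf, fderiv_wirtinger hf,
    fderiv_wirtinger hf, fderiv_fderiv_comm hf (EuclideanSpace.single k 1),
    fderiv_fderiv_comm hf (EuclideanSpace.single k 1),
    fderiv_fderiv_comm hf (EuclideanSpace.single k Complex.I),
    fderiv_fderiv_comm hf (EuclideanSpace.single k Complex.I)]
  ring

theorem wirtinger_wirtingerBar_comm (hf : ContDiffAt ℝ 2 f p) (j k : Fin 2) :
    wirtinger j (wirtingerBar k f) p = wirtingerBar k (wirtinger j f) p := by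
  rw [wirtinger, wirtingerBar, fderiv_wirtinger hf, fderiv_wirtingerBar hf, fderiv_wirtinger hf,
    fderiv_wirtingerBar hf, fderiv_fderiv_comm hf (EuclideanSpace.single k 1),
    fderiv_fderiv_comm hf (EuclideanSpace.single k 1),
    fderiv_fderiv_comm hf (EuclideanSpace.single k Complex.I),
    fderiv_fderiv_comm hf (EuclideanSpace.single k Complex.I)]
  ring

end calculus

section calculus

variable {f g : CTwo → ℂ} {p : CTwo}

theorem differentiableAt_wirtingerBar (hf : ContDiffAt ℝ 2 f p) (j : Fin 2) :
    DifferentiableAt ℝ (wirtingerBar j f) p :=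
  (contDiffAt_wirtingerBar (n := 2) (m := 1) hf (by norm_num) j).differentiableAt (by norm_num)

theorem differentiableAt_wirtinger (hf : ContDiffAt ℝ 2 f p) (j : Fin 2) :
    DifferentiableAt ℝ (wirtinger j f) p :=
  (contDiffAt_wirtinger (n := 2) (m := 1) hf (by norm_num) j).differentiableAt (by norm_num)

theorem eventually_differentiableAt (hf : ContDiffAt ℝ 2 f p) :
    ∀ᶠ q in 𝓝 p, DifferentiableAt ℝ f q :=
  (hf.eventually (by simp)).mono fun _ h => h.differentiableAt (by norm_num)

theorem cHess_add (hf : ContDiffAt ℝ 2 f p) (hg : ContDiffAt ℝ 2 g p) (a b : CTwo) :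
    cHess (fun q => f q + g q) p a b = cHess f p a b + cHess g p a b := by
  have h : ∀ k, wirtingerBar k (fun q => f q + g q) =ᶠ[𝓝 p]
      fun q => wirtingerBar k f q + wirtingerBar k g q := fun k => by
    filter_upwards [eventually_differentiableAt hf, eventually_differentiableAt hg] with q h1 h2
    exact wirtingerBar_add h1 h2 k
  simp only [cHess, wirtinger_congr (h _), wirtinger_add (differentiableAt_wirtingerBar hf _)
    (differentiableAt_wirtingerBar hg _), Fin.sum_univ_two]
  ring

theorem cHess_const_mul (hf : ContDiffAt ℝ 2 f p) (c : ℂ) (a b : CTwo) :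
    cHess (fun q => c * f q) p a b = c * cHess f p a b := by
  have h : ∀ k, wirtingerBar k (fun q => c * f q) =ᶠ[𝓝 p]
      fun q => c * wirtingerBar k f q := fun k => by
    filter_upwards [eventually_differentiableAt hf] with q h1
    rw [wirtingerBar_mul (differentiableAt_const c) h1, wirtingerBar_const]; ring
  simp only [cHess, wirtinger_congr (h _), wirtinger_mul (differentiableAt_const c)
    (differentiableAt_wirtingerBar hf _), wirtinger_const, Fin.sum_univ_two]
  ring

theorem cDeriv_const_mul (hf : DifferentiableAt ℝ f p) (c : ℂ) (a : CTwo) :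
    cDeriv a (fun q => c * f q) p = c * cDeriv a f p := by
  simp only [cDeriv, wirtinger_mul (differentiableAt_const c) hf, wirtinger_const,
    Fin.sum_univ_two]
  ring

theorem cDeriv_add (hf : DifferentiableAt ℝ f p) (hg : DifferentiableAt ℝ g p) (a : CTwo) :
    cDeriv a (fun q => f q + g q) p = cDeriv a f p + cDeriv a g p := by
  simp only [cDeriv, wirtinger_add hf hg, Fin.sum_univ_two]
  ring

theorem cDeriv_mul (hf : DifferentiableAt ℝ f p) (hg : DifferentiableAt ℝ g p) (a : CTwo) :
    cDeriv a (fun q => f q * g q) p = f p * cDeriv a g p + g p * cDeriv a f p := by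
  simp only [cDeriv, wirtinger_mul hf hg, Fin.sum_univ_two]
  ring

theorem cHess_mul (hf : ContDiffAt ℝ 2 f p) (hg : ContDiffAt ℝ 2 g p) (a b : CTwo) :
    cHess (fun q => f q * g q) p a b = f p * cHess g p a b + g p * cHess f p a b
      + cDeriv a f p * cDerivBar b g p + cDeriv a g p * cDerivBar b f p := by
  have h : ∀ k, wirtingerBar k (fun q => f q * g q) =ᶠ[𝓝 p]
      fun q => f q * wirtingerBar k g q + g q * wirtingerBar k f q := fun k => by
    filter_upwards [eventually_differentiableAt hf, eventually_differentiableAt hg] with q h1 h2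
    exact wirtingerBar_mul h1 h2 k
  have df := hf.differentiableAt (by norm_num)
  have dg := hg.differentiableAt (by norm_num)
  have h2 : ∀ j k, wirtinger j (wirtingerBar k (fun q => f q * g q)) p
      = f p * wirtinger j (wirtingerBar k g) p + wirtingerBar k g p * wirtinger j f p
        + (g p * wirtinger j (wirtingerBar k f) p + wirtingerBar k f p * wirtinger j g p) := by
    intro j k
    have d1 := differentiableAt_wirtingerBar hg k
    have d2 := differentiableAt_wirtingerBar hf k
    rw [wirtinger_congr (h k), wirtinger_add (df.fun_mul d1) (dg.fun_mul d2), wirtinger_mul df d1,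
      wirtinger_mul dg d2]
  simp only [cHess, h2, cDeriv, cDerivBar, Fin.sum_univ_two]
  ring

theorem cDerivBar_conj (hf : DifferentiableAt ℝ f p) (a : CTwo) :
    cDerivBar a (fun q => conj (f q)) p = conj (cDeriv a f p) := by
  simp only [cDerivBar, cDeriv, wirtingerBar_conj hf, map_sum, map_mul]

theorem cDeriv_conj (hf : DifferentiableAt ℝ f p) (a : CTwo) :
    cDeriv a (fun q => conj (f q)) p = conj (cDerivBar a f p) := by
  simp only [cDerivBar, cDeriv, wirtinger_conj hf, map_sum, map_mul, Complex.conj_conj]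

end calculus

/-! ### Real functions: Hermitian symmetry, chain rule, Laplacian. -/

section real

variable {f g : CTwo → ℝ} {p : CTwo}

theorem complexHess_eq_cHess (f : CTwo → ℝ) (p a b : CTwo) :
    complexHess f p a b = cHess (toComplexFun f) p a b := rfl

theorem holDeriv_eq_cDeriv (a : CTwo) (f : CTwo → ℝ) (p : CTwo) :
    holDeriv a f p = cDeriv a (toComplexFun f) p := rfl

theorem contDiffAt_toComplexFun {n : ℕ∞ω} (hf : ContDiffAt ℝ n f p) :
    ContDiffAt ℝ n (toComplexFun f) p :=
  Complex.ofRealCLM.contDiff.contDiffAt.comp p hf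

theorem contDiff_toComplexFun {n : ℕ∞ω} (hf : ContDiff ℝ n f) : ContDiff ℝ n (toComplexFun f) :=
  Complex.ofRealCLM.contDiff.comp hf

theorem differentiableAt_toComplexFun (hf : DifferentiableAt ℝ f p) :
    DifferentiableAt ℝ (toComplexFun f) p :=
  Complex.ofRealCLM.differentiableAt.comp p hf

theorem fderiv_toComplexFun (hf : DifferentiableAt ℝ f p) (v : CTwo) :
    fderiv ℝ (toComplexFun f) p v = (fderiv ℝ f p v : ℂ) := by
  have := (Complex.ofRealCLM.hasFDerivAt (x := f p)).comp p hf.hasFDerivAt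
  have h2 : HasFDerivAt (toComplexFun f) _ p := this
  rw [h2.fderiv]; simp

theorem toComplexFun_conj (f : CTwo → ℝ) :
    (fun q => conj (toComplexFun f q)) = toComplexFun f := by
  ext q; simp [toComplexFun]

theorem wirtingerBar_toComplexFun (hf : DifferentiableAt ℝ f p) (j : Fin 2) :
    wirtingerBar j (toComplexFun f) p = conj (wirtinger j (toComplexFun f) p) := by
  rw [← wirtingerBar_conj (differentiableAt_toComplexFun hf), toComplexFun_conj]

theorem cDerivBar_toComplexFun (hf : DifferentiableAt ℝ f p) (a : CTwo) :
    cDerivBar a (toComplexFun f) p = conj (cDeriv a (toComplexFun f) p) := by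
  rw [← cDerivBar_conj (differentiableAt_toComplexFun hf), toComplexFun_conj]

/-- For real f the ∂ and ∂̄ parts of df are conjugate. This is the bridge from Wirtinger identities
to monotonicity along real lines. -/
theorem fderiv_eq_two_re (hf : DifferentiableAt ℝ f p) (a : CTwo) :
    fderiv ℝ f p a = 2 * (cDeriv a (toComplexFun f) p).re := by
  have h := fderiv_eq_wirtinger (toComplexFun f) p a
  rw [fderiv_toComplexFun hf, cDerivBar_toComplexFun hf, Complex.add_conj] at h
  exact_mod_cast h

theorem wirtinger_wirtingerBar_conj (hf : ContDiffAt ℝ 2 f p) (j k : Fin 2) :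
    conj (wirtinger j (wirtingerBar k (toComplexFun f)) p)
      = wirtinger k (wirtingerBar j (toComplexFun f)) p := by
  have h : (fun q => conj (wirtingerBar k (toComplexFun f) q))
      =ᶠ[𝓝 p] wirtinger k (toComplexFun f) := by
    filter_upwards [hf.eventually (by simp)] with q hq
    rw [wirtingerBar_toComplexFun (hq.differentiableAt (by norm_num)), Complex.conj_conj]
  have hc := contDiffAt_toComplexFun hf
  rw [← wirtingerBar_conj (differentiableAt_wirtingerBar hc k), wirtingerBar_congr h,
    wirtinger_wirtingerBar_comm hc]

theorem cHess_conj (hf : ContDiffAt ℝ 2 f p) (a b : CTwo) :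
    conj (cHess (toComplexFun f) p a b) = cHess (toComplexFun f) p b a := by
  simp only [cHess, map_sum, map_mul, Complex.conj_conj, wirtinger_wirtingerBar_conj hf]
  rw [Finset.sum_comm]
  refine Finset.sum_congr rfl fun j _ => Finset.sum_congr rfl fun k _ => ?_
  ring

theorem cHess_im (hf : ContDiffAt ℝ 2 f p) (a : CTwo) :
    (cHess (toComplexFun f) p a a).im = 0 :=
  Complex.conj_eq_iff_im.1 (cHess_conj hf a a)

theorem cHess_self_ofReal (hf : ContDiffAt ℝ 2 f p) (a : CTwo) :
    ((cHess (toComplexFun f) p a a).re : ℂ) = cHess (toComplexFun f) p a a :=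
  Complex.ext (by simp) (by simp [cHess_im hf])

theorem wirtinger_comp {G : ℝ → ℝ} {G' : ℝ} (hG : HasDerivAt G G' (f p))
    (hf : DifferentiableAt ℝ f p) (j : Fin 2) :
    wirtinger j (toComplexFun fun q => G (f q)) p = G' * wirtinger j (toComplexFun f) p := by
  have h := hG.comp_hasFDerivAt p hf.hasFDerivAt
  have hd : DifferentiableAt ℝ (fun q => G (f q)) p := h.differentiableAt
  have h' : fderiv ℝ (fun q => G (f q)) p = G' • fderiv ℝ f p := h.fderiv
  simp only [wirtinger, fderiv_toComplexFun hd, fderiv_toComplexFun hf, h', smul_apply,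
    smul_eq_mul, Complex.ofReal_mul]
  ring

theorem cDeriv_comp {G : ℝ → ℝ} {G' : ℝ} (hG : HasDerivAt G G' (f p))
    (hf : DifferentiableAt ℝ f p) (a : CTwo) :
    cDeriv a (toComplexFun fun q => G (f q)) p = G' * cDeriv a (toComplexFun f) p := by
  simp only [cDeriv, wirtinger_comp hG hf, Fin.sum_univ_two]; ring

theorem cHess_comp {G : ℝ → ℝ} (hG : ContDiffAt ℝ 2 G (f p)) (hf : ContDiffAt ℝ 2 f p)
    (a b : CTwo) :
    cHess (toComplexFun fun q => G (f q)) p a b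
      = deriv (deriv G) (f p) * (cDeriv a (toComplexFun f) p * conj (cDeriv b (toComplexFun f) p))
        + deriv G (f p) * cHess (toComplexFun f) p a b := by
  have df := hf.differentiableAt (by norm_num)
  have hG1 : ∀ᶠ q in 𝓝 p, DifferentiableAt ℝ G (f q) :=
    hf.continuousAt.eventually
      ((hG.eventually (by simp)).mono fun x hx => hx.differentiableAt (by norm_num))
  have hdG : DifferentiableAt ℝ (deriv G) (f p) := by
    have : ContDiffAt ℝ 1 (deriv G) (f p) := by
      have h1 : ContDiffAt ℝ 1 (fderiv ℝ G) (f p) := hG.fderiv_right (by norm_num)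
      have h2 : deriv G = fun x => fderiv ℝ G x 1 := by ext x; simp
      rw [h2]; fun_prop
    exact this.differentiableAt (by norm_num)
  have hc := contDiffAt_toComplexFun hf
  have h : ∀ k, wirtingerBar k (toComplexFun fun q => G (f q)) =ᶠ[𝓝 p]
      fun q => toComplexFun (fun q => deriv G (f q)) q * wirtingerBar k (toComplexFun f) q := by
    intro k
    filter_upwards [hG1, hf.eventually (by simp)] with q h1 h2
    have h2 := h2.differentiableAt (by norm_num)
    rw [wirtingerBar_toComplexFun (f := fun q => G (f q)) (h1.comp q h2), wirtinger_comp h1.hasDerivAt h2,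
      wirtingerBar_toComplexFun h2]
    simp [toComplexFun]
  have key : ∀ j k, wirtinger j (wirtingerBar k (toComplexFun fun q => G (f q))) p
      = deriv G (f p) * wirtinger j (wirtingerBar k (toComplexFun f)) p
        + conj (wirtinger k (toComplexFun f) p)
          * (deriv (deriv G) (f p) * wirtinger j (toComplexFun f) p) := by
    intro j k
    rw [wirtinger_congr (h k), wirtinger_mul
      (differentiableAt_toComplexFun (f := fun q => deriv G (f q)) (hdG.comp p df)) (differentiableAt_wirtingerBar hc k),
      wirtinger_comp hdG.hasDerivAt df, wirtingerBar_toComplexFun df]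
    rfl
  simp only [cHess, key, cDeriv, Fin.sum_univ_two, map_add, map_mul]
  ring

theorem cHess_eq_cDeriv (f : CTwo → ℂ) (hf : ContDiffAt ℝ 2 f p) (a b : CTwo) :
    cHess f p a b = cDeriv a (cDerivBar b f) p := by
  have h : cDerivBar b f = fun q => conj (b 0) * wirtingerBar 0 f q
      + conj (b 1) * wirtingerBar 1 f q := by
    ext q; simp [cDerivBar, Fin.sum_univ_two]
  have d0 := differentiableAt_wirtingerBar hf 0
  have d1 := differentiableAt_wirtingerBar hf 1
  rw [h, cDeriv_add (d0.const_mul _) (d1.const_mul _), cDeriv_const_mul d0, cDeriv_const_mul d1]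
  simp only [cHess, cDeriv, Fin.sum_univ_two]
  ring

/-- The complex Hessian is a quarter of the Laplacian along the complex line. -/
theorem cHess_re_eq_laplacian (hf : ContDiffAt ℝ 2 f p) (b : CTwo) :
    (cHess (toComplexFun f) p b b).re
      = (fderiv ℝ (fun q => fderiv ℝ f q b) p b
        + fderiv ℝ (fun q => fderiv ℝ f q (Complex.I • b)) p (Complex.I • b)) / 4 := by
  have hd : DifferentiableAt ℝ (fderiv ℝ f) p :=
    (hf.fderiv_right (m := 1) (by norm_num)).differentiableAt (by norm_num)
  have d : ∀ v, DifferentiableAt ℝ (fun q => fderiv ℝ f q v) p := fun v => by fun_prop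
  have h : cDerivBar b (toComplexFun f) =ᶠ[𝓝 p]
      fun q => (1 / 2 : ℂ) * toComplexFun (fun q => fderiv ℝ f q b) q
        + (Complex.I / 2) * toComplexFun (fun q => fderiv ℝ f q (Complex.I • b)) q := by
    filter_upwards [hf.eventually (by simp)] with q hq
    have hq := hq.differentiableAt (by norm_num)
    rw [cDerivBar_eq_fderiv, fderiv_toComplexFun hq, fderiv_toComplexFun hq]
    simp only [toComplexFun]; ring
  rw [cHess_eq_cDeriv _ (contDiffAt_toComplexFun hf), cDeriv_congr h,
    cDeriv_add ((differentiableAt_toComplexFun (d _)).const_mul _)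
      ((differentiableAt_toComplexFun (d _)).const_mul _),
    cDeriv_const_mul (differentiableAt_toComplexFun (d _)),
    cDeriv_const_mul (differentiableAt_toComplexFun (d _)), cDeriv_eq_fderiv, cDeriv_eq_fderiv]
  simp only [fderiv_toComplexFun (d _)]
  simp
  ring

end real

/-! ### Smooth extension, and plurisubharmonicity from the complex Hessian. -/

theorem two_le_infty : (2 : ℕ∞ω) ≤ ∞ := 
  WithTop.coe_le_coe.2 (le_top : (2 : ℕ∞) ≤ ⊤)

/-- A smooth function on an open set agrees near a compact subset with a globally smooth one. -/
theorem exists_contDiff_eventuallyEq {E : Type*} [NormedAddCommGroup E] [NormedSpace ℝ E]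
    [FiniteDimensional ℝ E] {f : E → ℝ} {U K : Set E} (hU : IsOpen U) (hK : IsCompact K)
    (hKU : K ⊆ U) (hf : ContDiffOn ℝ ∞ f U) :
    ∃ g : E → ℝ, ContDiff ℝ ∞ g ∧ ∃ W, IsOpen W ∧ K ⊆ W ∧ W ⊆ U ∧ ∀ x ∈ W, g x = f x := by
  obtain ⟨V, hV, hKV, hVU⟩ := exists_open_between_and_isCompact_closure hK hU hKU
  -- The cutoff is 1 near K and 0 off V. Since the closure of V lies in U, the product χ f is smooth
  -- everywhere, whatever values f takes outside U.
  obtain ⟨χ, h1, h0, -⟩ := exists_contMDiffMap_one_nhds_of_subset_interior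
    (I := modelWithCornersSelf ℝ E) (n := ⊤) hK.isClosed (t := V)
    (by rwa [hV.interior_eq])
  have hχ : ContDiff ℝ ∞ χ := χ.contMDiff.contDiff
  obtain ⟨W, hW, hKW, hW1⟩ := mem_nhdsSet_iff_exists.1 h1
  refine ⟨fun x => χ x * f x, ?_, W ∩ U, hW.inter hU, fun x hx => ⟨hKW hx, hKU hx⟩,
    fun x hx => hx.2, fun x hx => ?_⟩
  · rw [contDiff_iff_contDiffAt]
    intro x
    by_cases hx : x ∈ U
    · exact hχ.contDiffAt.mul (hf.contDiffAt (hU.mem_nhds hx))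
    · have : (fun y => χ y * f y) =ᶠ[𝓝 x] fun _ => 0 := by
        have hx' : x ∉ closure V := fun h => hx (hVU.1 h)
        filter_upwards [isClosed_closure.isOpen_compl.mem_nhds hx'] with y hy
        rw [h0 y fun h => hy (subset_closure h), zero_mul]
      exact contDiffAt_const.congr_of_eventuallyEq this
  · have : χ x = 1 := hW1 hx.1
    simp [this]

theorem hasDerivAt_intervalIntegral_of_continuous {F F' : ℝ → ℝ → ℝ}
    (hF : Continuous (Function.uncurry F)) (hF' : Continuous (Function.uncurry F'))
    (h : ∀ r θ, HasDerivAt (fun r => F r θ) (F' r θ) r) (a b r : ℝ) :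
    HasDerivAt (fun r => ∫ θ in a..b, F r θ) (∫ θ in a..b, F' r θ) r := by
  have hK : IsCompact (Set.Icc (r - 1) (r + 1) ×ˢ Set.uIcc a b) :=
    isCompact_Icc.prod isCompact_uIcc
  obtain ⟨C, hC⟩ := hK.exists_bound_of_continuousOn hF'.continuousOn
  refine (intervalIntegral.hasDerivAt_integral_of_dominated_loc_of_deriv_le
    (F := F) (F' := F') (bound := fun _ => C) (s := Set.Icc (r - 1) (r + 1))
    (Icc_mem_nhds (by linarith) (by linarith)) ?_ ?_ ?_ ?_ ?_ ?_).2
  · exact Eventually.of_forall fun x =>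
      (hF.comp (Continuous.prodMk_right x)).aestronglyMeasurable
  · exact (hF.comp (Continuous.prodMk_right r)).intervalIntegrable _ _
  · exact (hF'.comp (Continuous.prodMk_right r)).aestronglyMeasurable
  · exact Eventually.of_forall fun θ hθ x hx => hC (x, θ) ⟨hx, Set.uIoc_subset_uIcc hθ⟩
  · exact intervalIntegrable_const
  · exact Eventually.of_forall fun θ _ x _ => h x θ

set_option maxHeartbeats 1000000 in
/-- The sub-mean value inequality for functions with nonnegative Laplacian on the unit disc. -/
theorem le_circleAverage_of_laplacian_nonneg {f : ℂ → ℝ} (hf : ContDiff ℝ 2 f)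
    (hΔ : ∀ z : ℂ, ‖z‖ ≤ 1 → 0 ≤ fderiv ℝ (fderiv ℝ f) z 1 1
      + fderiv ℝ (fderiv ℝ f) z Complex.I Complex.I) :
    f 0 ≤ Real.circleAverage f 0 1 := by
  set e : ℝ → ℂ := fun θ => Complex.exp (θ * Complex.I) with he
  have hec : Continuous e := by fun_prop
  have hde : ∀ θ, HasDerivAt e (Complex.I * e θ) θ := fun θ => by
    have h1 : HasDerivAt (fun θ : ℝ => (θ : ℂ) * Complex.I) (1 * Complex.I) θ :=
      (Complex.ofRealCLM.hasDerivAt (x := θ)).mul_const _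
    have := h1.cexp
    convert this using 1
    simp only [he]; ring
  have hdie : ∀ θ, HasDerivAt (fun θ => Complex.I * e θ) (-e θ) θ := fun θ => by
    have := (hde θ).const_mul Complex.I
    rw [← mul_assoc, Complex.I_mul_I, neg_one_mul] at this
    exact this
  have hne : ∀ θ, ‖e θ‖ = 1 := fun θ => Complex.norm_exp_ofReal_mul_I θ
  have hf1 : ContDiff ℝ 1 (fderiv ℝ f) := hf.fderiv_right (by norm_num)
  have c1 : Continuous (fderiv ℝ f) := hf1.continuous
  have c2 : Continuous (fderiv ℝ (fderiv ℝ f)) := hf1.continuous_fderiv (by norm_num)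
  have d0 : ∀ z, HasFDerivAt f (fderiv ℝ f z) z := fun z =>
    (hf.differentiable (by norm_num) z).hasFDerivAt
  have d1 : ∀ z, HasFDerivAt (fderiv ℝ f) (fderiv ℝ (fderiv ℝ f) z) z := fun z =>
    (hf1.differentiable (by norm_num) z).hasFDerivAt
  have hray : ∀ r θ : ℝ, HasDerivAt (fun r : ℝ => (r : ℂ) * e θ) (e θ) r := fun r θ => by
    have := (Complex.ofRealCLM.hasDerivAt (x := r)).mul_const (e θ)
    simpa using this
  have hcirc : ∀ r θ : ℝ, HasDerivAt (fun θ : ℝ => (r : ℂ) * e θ) (r * (Complex.I * e θ)) θ :=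
    fun r θ => (hde θ).const_mul _
  set B := fun z : ℂ => fderiv ℝ (fderiv ℝ f) z with hB
  -- the mean, its radial derivative and the second radial derivative
  set P : ℝ → ℝ := fun r => ∫ θ in (0 : ℝ)..2 * Real.pi, f (r * e θ) with hP
  set P' : ℝ → ℝ := fun r => ∫ θ in (0 : ℝ)..2 * Real.pi, fderiv ℝ f (r * e θ) (e θ) with hP'
  have hPd : ∀ r : ℝ, HasDerivAt P (P' r) r := fun r => by
    refine hasDerivAt_intervalIntegral_of_continuous (F := fun r θ : ℝ => f (r * e θ))
      (F' := fun r θ : ℝ => fderiv ℝ f (r * e θ) (e θ)) ?_ ?_ ?_ _ _ r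
    · have := hf.continuous
      simp only [Function.uncurry_def]; fun_prop
    · simp only [Function.uncurry_def]; fun_prop
    · intro r θ
      exact (d0 _).comp_hasDerivAt r (hray r θ)
  have hP'd : ∀ r : ℝ, HasDerivAt P' (∫ θ in (0 : ℝ)..2 * Real.pi, B (r * e θ) (e θ) (e θ)) r :=
    fun r => by
    refine hasDerivAt_intervalIntegral_of_continuous
      (F := fun r θ : ℝ => fderiv ℝ f (r * e θ) (e θ))
      (F' := fun r θ : ℝ => B (r * e θ) (e θ) (e θ)) ?_ ?_ ?_ _ _ r
    · simp only [Function.uncurry_def]; fun_prop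
    · simp only [Function.uncurry_def, hB]; fun_prop
    · intro r θ
      have := ((d1 (r * e θ)).comp_hasDerivAt r (hray r θ)).clm_apply (hasDerivAt_const r (e θ))
      simpa using this
  -- The integrand is the θ-derivative of a periodic function. This trades the first radial
  -- derivative for the second derivative in the angular direction.
  have hper : ∀ r : ℝ, ∫ θ in (0 : ℝ)..2 * Real.pi,
      (r * B (r * e θ) (Complex.I * e θ) (Complex.I * e θ) - fderiv ℝ f (r * e θ) (e θ)) = 0 := by
    intro r
    have hd : ∀ θ : ℝ, HasDerivAt (fun θ : ℝ => fderiv ℝ f (r * e θ) (Complex.I * e θ))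
        (r * B (r * e θ) (Complex.I * e θ) (Complex.I * e θ) - fderiv ℝ f (r * e θ) (e θ)) θ := by
      intro θ
      have h1 : HasDerivAt (fun θ : ℝ => fderiv ℝ f (r * e θ)) (B (r * e θ) (r • (Complex.I * e θ)))
          θ := by
        rw [Complex.real_smul]
        exact (d1 (r * e θ)).comp_hasDerivAt θ (hcirc r θ)
      have h2 := h1.clm_apply (hdie θ)
      rwa [map_smul, smul_apply, smul_eq_mul, map_neg, ← sub_eq_add_neg] at h2
    rw [intervalIntegral.integral_eq_sub_of_hasDerivAt (fun θ _ => hd θ)]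
    · simp [he]
    · apply Continuous.intervalIntegrable
      simp only [hB]; fun_prop
  -- Polar form of the Laplacian: (rP')' is r times the integral of the Laplacian over the circle.
  -- So rP' increases from 0, hence P' ≥ 0 and the mean P increases.
  set R : ℝ → ℝ := fun r => r * P' r with hR
  have hRd : ∀ r : ℝ, HasDerivAt R (r * ∫ θ in (0 : ℝ)..2 * Real.pi,
      (B (r * e θ) (e θ) (e θ) + B (r * e θ) (Complex.I * e θ) (Complex.I * e θ))) r := by
    intro r
    have h1 : HasDerivAt R (1 * P' r + r * ∫ θ in (0 : ℝ)..2 * Real.pi, B (r * e θ) (e θ) (e θ)) r :=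
      (hasDerivAt_id r).mul (hP'd r)
    have h0 := hper r
    rw [intervalIntegral.integral_sub, intervalIntegral.integral_const_mul, sub_eq_zero] at h0
    · rw [intervalIntegral.integral_add, mul_add, h0, add_comm]
      · rwa [one_mul] at h1
      · apply Continuous.intervalIntegrable; simp only [hB]; fun_prop
      · apply Continuous.intervalIntegrable; simp only [hB]; fun_prop
    · apply Continuous.intervalIntegrable; simp only [hB]; fun_prop
    · apply Continuous.intervalIntegrable; fun_prop
  have hrot : ∀ z w : ℂ, B z w w + B z (Complex.I * w) (Complex.I * w)
      = ‖w‖ ^ 2 * (B z 1 1 + B z Complex.I Complex.I) := by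
    intro z w
    have e1 : w = w.re • (1 : ℂ) + w.im • Complex.I := by
      apply Complex.ext <;> simp
    have e2 : Complex.I * w = w.re • Complex.I - w.im • (1 : ℂ) := by
      apply Complex.ext <;> simp
    rw [e2, Complex.sq_norm, Complex.normSq_apply]
    conv_lhs => rw [e1]
    simp only [map_add, map_sub, map_smul, add_apply, sub_apply, smul_apply, smul_eq_mul]
    simp
    ring
  have hRm : MonotoneOn R (Set.Icc 0 1) := by
    refine monotoneOn_of_hasDerivWithinAt_nonneg (convex_Icc 0 1)
      (fun r _ => (hRd r).continuousAt.continuousWithinAt)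
      (fun r _ => (hRd r).hasDerivWithinAt) fun r hr => ?_
    rw [interior_Icc] at hr
    refine mul_nonneg hr.1.le (intervalIntegral.integral_nonneg (by positivity) fun θ _ => ?_)
    rw [hrot, hne]
    have : ‖(r : ℂ) * e θ‖ ≤ 1 := by
      rw [norm_mul, hne, mul_one, Complex.norm_real, Real.norm_eq_abs, abs_of_pos hr.1]
      exact hr.2.le
    simpa using hΔ _ this
  have hPm : MonotoneOn P (Set.Icc 0 1) := by
    refine monotoneOn_of_hasDerivWithinAt_nonneg (convex_Icc 0 1)
      (fun r _ => (hPd r).continuousAt.continuousWithinAt)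
      (fun r _ => (hPd r).hasDerivWithinAt) fun r hr => ?_
    rw [interior_Icc] at hr
    have h0 : R 0 ≤ R r := hRm ⟨le_rfl, zero_le_one⟩ ⟨hr.1.le, hr.2.le⟩ hr.1.le
    simp only [hR, zero_mul] at h0
    exact nonneg_of_mul_nonneg_right h0 hr.1
  have h01 := hPm ⟨le_rfl, zero_le_one⟩ ⟨zero_le_one, le_rfl⟩ (zero_le_one' ℝ)
  have hP0 : P 0 = 2 * Real.pi * f 0 := by simp [hP]
  have hcm : ∀ θ, circleMap 0 1 θ = ((1 : ℝ) : ℂ) * e θ := fun θ => by simp [circleMap, he]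
  rw [Real.circleAverage_def, smul_eq_mul]
  simp only [hcm]
  rw [hP0] at h01
  rw [le_inv_mul_iff₀ (by positivity)]
  exact h01

/-- A function with nonnegative complex Hessian on an open set is plurisubharmonic. -/
theorem isPlurisubharmonicOn_of_cHess_nonneg {v : CTwo → ℝ} {Ω : Set CTwo} (hΩ : IsOpen Ω)
    (hv : ContDiffOn ℝ ∞ v Ω)
    (h : ∀ p ∈ Ω, ∀ b, 0 ≤ (cHess (toComplexFun v) p b b).re) : IsPlurisubharmonicOn v Ω := by
  refine ⟨hv.continuousOn.upperSemicontinuousOn, fun a b hab => ?_⟩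
  set l : ℂ → CTwo := fun ζ => a + ζ • b with hl
  have hlc : Continuous l := by fun_prop
  have hK : IsCompact (l '' Metric.closedBall 0 1) := (isCompact_closedBall 0 1).image hlc
  have hKΩ : l '' Metric.closedBall 0 1 ⊆ Ω := by
    rintro _ ⟨ζ, hζ, rfl⟩
    exact hab ζ (by simpa using hζ)
  -- The mean value lemma wants a function on all of ℂ, so v is replaced by a global function that
  -- agrees with it near the closed disc.
  obtain ⟨g, hg, W, hW, hKW, hWΩ, hgW⟩ := exists_contDiff_eventuallyEq hΩ hK hKΩ hv
  have hmem : ∀ ζ : ℂ, ‖ζ‖ ≤ 1 → l ζ ∈ W := fun ζ hζ =>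
    hKW ⟨ζ, by simpa using hζ, rfl⟩
  have hls : ContDiff ℝ ∞ l := by fun_prop
  have hgl : ContDiff ℝ ∞ (fun ζ => g (l ζ)) := hg.comp hls
  have hcirc : Set.EqOn (fun ζ => v (l ζ)) (fun ζ => g (l ζ)) (Metric.sphere 0 |1|) :=
    fun ζ hζ => (hgW _ (hmem ζ (by
      have : ‖ζ‖ = 1 := by simpa using hζ
      exact this.le))).symm
  have hint : CircleIntegrable (fun ζ => g (l ζ)) 0 1 :=
    hgl.continuous.continuousOn.circleIntegrable zero_le_one
  refine ⟨(circleIntegrable_congr hcirc).2 hint, ?_⟩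
  · have h0 : g (l 0) = v a := by
      rw [hgW _ (hmem 0 (by simp))]; simp [hl]
    rw [Real.circleAverage_congr_sphere hcirc, ← h0]
    refine le_circleAverage_of_laplacian_nonneg (f := fun ζ => g (l ζ))
      (hgl.of_le two_le_infty) fun z hz => ?_
    have hg2 : ContDiff ℝ 2 g := hg.of_le two_le_infty
    have hd1 : Differentiable ℝ (fderiv ℝ g) :=
      (hg2.fderiv_right (m := 1) (by norm_num)).differentiable (by norm_num)
    have hdl : ∀ ζ, HasFDerivAt l ((ContinuousLinearMap.id ℝ ℂ).smulRight b) ζ := fun ζ => by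
      have := ((ContinuousLinearMap.id ℝ ℂ).smulRight b).hasFDerivAt (x := ζ)
      exact this.const_add a
    have hfd : fderiv ℝ (fun ζ => g (l ζ)) = fun ζ =>
        (fderiv ℝ g (l ζ)).comp ((ContinuousLinearMap.id ℝ ℂ).smulRight b) := by
      ext1 ζ
      exact ((hg2.differentiable (by norm_num) (l ζ)).hasFDerivAt.comp ζ (hdl ζ)).fderiv
    have hsd : ∀ e : ℂ, fderiv ℝ (fderiv ℝ fun ζ => g (l ζ)) z e e
        = fderiv ℝ (fun q => fderiv ℝ g q (e • b)) (l z) (e • b) := by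
      intro e
      have d : DifferentiableAt ℝ (fderiv ℝ fun ζ => g (l ζ)) z :=
        ((hgl.of_le two_le_infty |>.fderiv_right (m := 1) (by norm_num)).differentiable (by norm_num)) z
      have h1 : fderiv ℝ (fun ζ => fderiv ℝ (fun ζ => g (l ζ)) ζ e) z e
          = fderiv ℝ (fderiv ℝ fun ζ => g (l ζ)) z e e := by
        rw [fderiv_clm_apply d (differentiableAt_const e)]; simp
      rw [← h1, hfd]
      have d2 : HasFDerivAt (fun q => fderiv ℝ g q (e • b)) _ (l z) :=
        (show DifferentiableAt ℝ (fun q => fderiv ℝ g q (e • b)) (l z) by fun_prop).hasFDerivAt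
      have := (d2.comp z (hdl z)).fderiv
      have e3 : (fun ζ => ((fderiv ℝ g (l ζ)).comp
          ((ContinuousLinearMap.id ℝ ℂ).smulRight b)) e)
          = (fun q => fderiv ℝ g q (e • b)) ∘ l := by ext ζ; simp
      rw [e3, this]; simp
    have hp := h (l z) (hWΩ (hmem z hz)) b
    have hcg : toComplexFun v =ᶠ[𝓝 (l z)] toComplexFun g := by
      filter_upwards [hW.mem_nhds (hmem z hz)] with q hq
      simp [toComplexFun, hgW q hq]
    rw [cHess_congr hcg, cHess_re_eq_laplacian hg2.contDiffAt] at hp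
    rw [hsd, hsd, one_smul]
    linarith

/-! ### The unnormalized tangential-normal frame. -/

section frame

/-- The tangential field `∂δ/∂w ∂/∂z - ∂δ/∂z ∂/∂w`, without normalization. -/
noncomputable def tanField (δ : CTwo → ℝ) (p : CTwo) : CTwo :=
  !₂[wirtinger 1 (toComplexFun δ) p, -wirtinger 0 (toComplexFun δ) p]

/-- The normal field `∂δ/∂z̄ ∂/∂z + ∂δ/∂w̄ ∂/∂w`, without normalization. -/
noncomputable def norField (δ : CTwo → ℝ) (p : CTwo) : CTwo :=
  !₂[wirtingerBar 0 (toComplexFun δ) p, wirtingerBar 1 (toComplexFun δ) p]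

/-- `|∂δ/∂z|² + |∂δ/∂w|²`. -/
noncomputable def delSq (δ : CTwo → ℝ) (p : CTwo) : ℝ :=
  ‖wirtinger 0 (toComplexFun δ) p‖ ^ 2 + ‖wirtinger 1 (toComplexFun δ) p‖ ^ 2

/-- The Levi form on the unnormalized tangential field. -/
noncomputable def leviTan (δ : CTwo → ℝ) (p : CTwo) : ℝ :=
  (cHess (toComplexFun δ) p (tanField δ p) (tanField δ p)).re

/-- The mixed entry of the complex Hessian in the unnormalized frame, as a function of the normal
and the tangential field in this order. -/
noncomputable def hessNorTan (δ : CTwo → ℝ) (p : CTwo) : ℂ :=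
  cHess (toComplexFun δ) p (norField δ p) (tanField δ p)

variable {δ : CTwo → ℝ} {p : CTwo}

theorem delSq_nonneg (δ : CTwo → ℝ) (p : CTwo) : 0 ≤ delSq δ p := by unfold delSq; positivity

theorem delSq_eq_sum (hδ : DifferentiableAt ℝ δ p) : (delSq δ p : ℂ)
    = wirtinger 0 (toComplexFun δ) p * wirtingerBar 0 (toComplexFun δ) p
      + wirtinger 1 (toComplexFun δ) p * wirtingerBar 1 (toComplexFun δ) p := by
  rw [wirtingerBar_toComplexFun hδ, wirtingerBar_toComplexFun hδ, Complex.mul_conj',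
    Complex.mul_conj', delSq]
  push_cast; rfl

theorem cDeriv_tanField : cDeriv (tanField δ p) (toComplexFun δ) p = 0 := by
  simp [cDeriv, tanField, Fin.sum_univ_two]; ring

theorem cDeriv_norField (hδ : DifferentiableAt ℝ δ p) :
    cDeriv (norField δ p) (toComplexFun δ) p = delSq δ p := by
  rw [delSq_eq_sum hδ]
  simp [cDeriv, norField, Fin.sum_univ_two]; ring

/-- Cramer's rule: the determinant of the two fields is `delSq`. -/
theorem frame_decomp (hδ : DifferentiableAt ℝ δ p) (hD : delSq δ p ≠ 0) (Z : CTwo) :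
    ∃ a b : ℂ, Z = a • tanField δ p + b • norField δ p := by
  have hD' : (delSq δ p : ℂ) ≠ 0 := by exact_mod_cast hD
  refine ⟨(wirtingerBar 1 (toComplexFun δ) p * Z 0 - wirtingerBar 0 (toComplexFun δ) p * Z 1)
    / delSq δ p, (wirtinger 0 (toComplexFun δ) p * Z 0 + wirtinger 1 (toComplexFun δ) p * Z 1)
    / delSq δ p, ?_⟩
  have h := delSq_eq_sum hδ
  ext k
  fin_cases k
  · simp [tanField, norField]
    field_simp
    rw [h]; ring
  · simp [tanField, norField]
    field_simp
    rw [h]; ring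

theorem cDeriv_add_vec (a b : CTwo) (f : CTwo → ℂ) (p : CTwo) :
    cDeriv (a + b) f p = cDeriv a f p + cDeriv b f p := by
  simp [cDeriv, Fin.sum_univ_two]; ring

theorem cHess_add_left (f : CTwo → ℂ) (p a b c : CTwo) :
    cHess f p (a + b) c = cHess f p a c + cHess f p b c := by
  simp [cHess, Fin.sum_univ_two]; ring

theorem cHess_add_right (f : CTwo → ℂ) (p a b c : CTwo) :
    cHess f p a (b + c) = cHess f p a b + cHess f p a c := by
  simp [cHess, Fin.sum_univ_two]; ring

theorem cHess_smul_left (f : CTwo → ℂ) (p a b : CTwo) (c : ℂ) :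
    cHess f p (c • a) b = c * cHess f p a b := by
  simp [cHess, Fin.sum_univ_two]; ring

theorem cHess_smul_right (f : CTwo → ℂ) (p a b : CTwo) (c : ℂ) :
    cHess f p a (c • b) = conj c * cHess f p a b := by
  simp [cHess, Fin.sum_univ_two]; ring

theorem hessNorTan_conj (hδ : ContDiffAt ℝ 2 δ p) :
    conj (hessNorTan δ p) = cHess (toComplexFun δ) p (tanField δ p) (norField δ p) :=
  cHess_conj hδ _ _

theorem leviTan_ofReal (hδ : ContDiffAt ℝ 2 δ p) :
    (leviTan δ p : ℂ) = cHess (toComplexFun δ) p (tanField δ p) (tanField δ p) :=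
  cHess_self_ofReal hδ _

end frame

/-! ### Smooth dependence of the frame quantities on the point. -/

section smooth

variable {δ : CTwo → ℝ}

theorem contDiff_conj {f : CTwo → ℂ} {n : ℕ∞ω} (hf : ContDiff ℝ n f) :
    ContDiff ℝ n fun q => conj (f q) := Complex.conjCLE.contDiff.comp hf

theorem contDiff_tanField (hδ : ContDiff ℝ ∞ δ) (k : Fin 2) :
    ContDiff ℝ ∞ fun q => tanField δ q k := by
  have h := fun j => contDiff_wirtinger (contDiff_toComplexFun hδ) j
  fin_cases k
  · simpa [tanField] using h 1
  · simpa [tanField] using (h 0).neg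

theorem contDiff_norField (hδ : ContDiff ℝ ∞ δ) (k : Fin 2) :
    ContDiff ℝ ∞ fun q => norField δ q k := by
  have h := fun j => contDiff_wirtingerBar (contDiff_toComplexFun hδ) j
  fin_cases k
  · simpa [norField] using h 0
  · simpa [norField] using h 1

theorem contDiff_cHess {f : CTwo → ℂ} (hf : ContDiff ℝ ∞ f) {a b : CTwo → CTwo}
    (ha : ∀ k, ContDiff ℝ ∞ fun q => a q k) (hb : ∀ k, ContDiff ℝ ∞ fun q => b q k) :
    ContDiff ℝ ∞ fun q => cHess f q (a q) (b q) := by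
  unfold cHess
  refine ContDiff.sum fun j _ => ContDiff.sum fun k _ => ?_
  exact ((ha j).mul (contDiff_conj (hb k))).mul (contDiff_wirtinger (contDiff_wirtingerBar hf k) j)

theorem contDiff_cDeriv {f : CTwo → ℂ} (hf : ContDiff ℝ ∞ f) {a : CTwo → CTwo}
    (ha : ∀ k, ContDiff ℝ ∞ fun q => a q k) :
    ContDiff ℝ ∞ fun q => cDeriv (a q) f q := by
  unfold cDeriv
  exact ContDiff.sum fun j _ => (ha j).mul (contDiff_wirtinger hf j)

theorem contDiff_leviTan (hδ : ContDiff ℝ ∞ δ) : ContDiff ℝ ∞ (leviTan δ) :=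
  Complex.reCLM.contDiff.comp (contDiff_cHess (contDiff_toComplexFun hδ) (contDiff_tanField hδ)
    (contDiff_tanField hδ))

theorem contDiff_hessNorTan (hδ : ContDiff ℝ ∞ δ) : ContDiff ℝ ∞ (hessNorTan δ) :=
  contDiff_cHess (contDiff_toComplexFun hδ) (contDiff_norField hδ) (contDiff_tanField hδ)

theorem contDiff_delSq (hδ : ContDiff ℝ ∞ δ) : ContDiff ℝ ∞ (delSq δ) := by
  have h := fun j => contDiff_wirtinger (contDiff_toComplexFun hδ) j
  unfold delSq
  exact ((h 0).norm_sq ℝ).add ((h 1).norm_sq ℝ)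

end smooth

/-! ### The normal derivative of the Levi form on the flat set. -/

section jet

theorem wirtinger_mul_mul {f g h : CTwo → ℂ} {p : CTwo} (hf : DifferentiableAt ℝ f p)
    (hg : DifferentiableAt ℝ g p) (hh : DifferentiableAt ℝ h p) (j : Fin 2) :
    wirtinger j (fun q => f q * g q * h q) p = f p * g p * wirtinger j h p
      + f p * wirtinger j g p * h p + wirtinger j f p * g p * h p := by
  rw [wirtinger_mul (hf.fun_mul hg) hh, wirtinger_mul hf hg]; ring

theorem cDeriv_contraction {a b : Fin 2 → CTwo → ℂ} {H : Fin 2 → Fin 2 → CTwo → ℂ} {p : CTwo}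
    (ha : ∀ j, DifferentiableAt ℝ (a j) p) (hb : ∀ j, DifferentiableAt ℝ (b j) p)
    (hH : ∀ j k, DifferentiableAt ℝ (H j k) p) (v : CTwo) :
    cDeriv v (fun q => ∑ j, ∑ k, a j q * b k q * H j k q) p
      = ∑ l, v l * ∑ j, ∑ k, (a j p * b k p * wirtinger l (H j k) p
        + a j p * wirtinger l (b k) p * H j k p + wirtinger l (a j) p * b k p * H j k p) := by
  have d : ∀ j k, DifferentiableAt ℝ (fun q => a j q * b k q * H j k q) p := fun j k =>
    ((ha j).fun_mul (hb k)).fun_mul (hH j k)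
  unfold cDeriv
  refine Finset.sum_congr rfl fun l _ => ?_
  simp only [Fin.sum_univ_two]
  rw [wirtinger_add ((d _ _).fun_add (d _ _)) ((d _ _).fun_add (d _ _)),
    wirtinger_add (d _ _) (d _ _), wirtinger_add (d _ _) (d _ _)]
  simp only [wirtinger_mul_mul (ha _) (hb _) (hH _ _)]

/-- At a Levi-flat point where the mixed Hessian vanishes, the normal derivative of the Levi form
is the tangential derivative of the mixed Hessian. -/
theorem cDeriv_norField_leviTan {δ : CTwo → ℝ} (hδ : ContDiff ℝ ∞ δ) {p : CTwo}
    (hD : delSq δ p ≠ 0) (hL : leviTan δ p = 0) (hF : hessNorTan δ p = 0) :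
    cDeriv (norField δ p) (toComplexFun (leviTan δ)) p
      = cDeriv (tanField δ p) (hessNorTan δ) p := by
  have h2 : ∀ q, ContDiffAt ℝ 2 δ q := fun q => (hδ.of_le two_le_infty).contDiffAt
  have hd : ∀ q, DifferentiableAt ℝ δ q := fun q => (h2 q).differentiableAt (by norm_num)
  have hc := contDiff_toComplexFun hδ
  have hc2 : ∀ {f : CTwo → ℂ}, ContDiff ℝ ∞ f → ContDiffAt ℝ 2 f p := fun hf =>
    (hf.of_le two_le_infty).contDiffAt
  set A : Fin 2 → CTwo → ℂ := fun j => wirtinger j (toComplexFun δ) with hA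
  set B : Fin 2 → CTwo → ℂ := fun j => wirtingerBar j (toComplexFun δ) with hB
  set H : Fin 2 → Fin 2 → CTwo → ℂ := fun j k => wirtinger j (B k) with hH
  have sA : ∀ j, ContDiff ℝ ∞ (A j) := fun j => contDiff_wirtinger hc j
  have sB : ∀ j, ContDiff ℝ ∞ (B j) := fun j => contDiff_wirtingerBar hc j
  have dA : ∀ j, DifferentiableAt ℝ (A j) p := fun j => (sA j).differentiable (by simp) p
  have dB : ∀ j, DifferentiableAt ℝ (B j) p := fun j => (sB j).differentiable (by simp) p
  have dH : ∀ j k, DifferentiableAt ℝ (H j k) p := fun j k =>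
    differentiableAt_wirtinger (hc2 (sB k)) j
  have cA : ∀ j q, conj (A j q) = B j q := fun j q => (wirtingerBar_toComplexFun (hd q) j).symm
  have cA' : ∀ j q, conj (wirtinger j (toComplexFun δ) q) = wirtingerBar j (toComplexFun δ) q := cA
  have cH : ∀ j k, conj (H j k p) = H k j p := fun j k => wirtinger_wirtingerBar_conj (h2 p) j k
  let a : Fin 2 → CTwo → ℂ := ![A 1, fun q => -A 0 q]
  let b : Fin 2 → CTwo → ℂ := ![B 1, fun q => -B 0 q]
  have da : ∀ j, DifferentiableAt ℝ (a j) p := by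
    intro j; fin_cases j
    · exact dA 1
    · exact (dA 0).fun_neg
  have db : ∀ j, DifferentiableAt ℝ (b j) p := by
    intro j; fin_cases j
    · exact dB 1
    · exact (dB 0).fun_neg
  have e1 : toComplexFun (leviTan δ) = fun q => ∑ j, ∑ k, a j q * b k q * H j k q := by
    ext q
    rw [toComplexFun, leviTan_ofReal (h2 q)]
    simp [cHess, tanField, Fin.sum_univ_two, a, b, cA', hA, hH, hB]
  have e2 : hessNorTan δ = fun q => ∑ j, ∑ k, B j q * b k q * H j k q := by
    ext q
    simp [hessNorTan, cHess, tanField, norField, Fin.sum_univ_two, b, cA', hH, hB]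
  have hL' : toComplexFun (leviTan δ) p = 0 := by simp [toComplexFun, hL]
  have hS := delSq_eq_sum (hd p)
  change (delSq δ p : ℂ) = A 0 p * B 0 p + A 1 p * B 1 p at hS
  have hD' : (delSq δ p : ℂ) ≠ 0 := by exact_mod_cast hD
  rw [hS] at hD'
  rw [e1] at hL'
  rw [e2] at hF
  simp only [Fin.sum_univ_two, a, b, Matrix.cons_val_zero, Matrix.cons_val_one] at hL' hF
  -- Hess(T,T) = Hess(n,T) = 0 and the frame is a basis, so T lies in the kernel of the Hessian.
  -- `r0` and `r1` express this in coordinates; `s0` and `s1` are their conjugates.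
  have r0 : H 0 0 p * B 1 p - H 0 1 p * B 0 p = 0 := by
    refine (mul_eq_zero.1 ?_).resolve_left hD'
    linear_combination B 1 p * hL' + A 0 p * hF
  have r1 : H 1 0 p * B 1 p - H 1 1 p * B 0 p = 0 := by
    refine (mul_eq_zero.1 ?_).resolve_left hD'
    linear_combination -B 0 p * hL' + A 1 p * hF
  have cB : ∀ j, conj (B j p) = A j p := fun j => by rw [← cA, Complex.conj_conj]
  have s0 : A 1 p * H 0 0 p - A 0 p * H 1 0 p = 0 := by
    have := congrArg conj r0
    simp only [map_sub, map_mul, cH, cB, map_zero] at this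
    linear_combination this
  have s1 : A 1 p * H 0 1 p - A 0 p * H 1 1 p = 0 := by
    have := congrArg conj r1
    simp only [map_sub, map_mul, cH, cB, map_zero] at this
    linear_combination this
  have hwA : ∀ l j, wirtinger l (A j) p = wirtinger j (A l) p := fun l j =>
    wirtinger_wirtinger_comm (hc2 hc) l j
  have hwH : ∀ l j k, wirtinger l (H j k) p = wirtinger j (H l k) p := fun l j k =>
    wirtinger_wirtinger_comm (hc2 (sB k)) l j
  have hwB : ∀ l j, wirtinger l (B j) p = H l j p := fun l j => rfl
  rw [e1, e2, cDeriv_contraction da db dH, cDeriv_contraction dB db dH]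
  have n0 : norField δ p 0 = B 0 p := rfl
  have n1 : norField δ p 1 = B 1 p := rfl
  have t0 : tanField δ p 0 = A 1 p := rfl
  have t1 : tanField δ p 1 = -A 0 p := rfl
  simp only [Fin.sum_univ_two, a, b, Matrix.cons_val_zero, Matrix.cons_val_one, n0, n1, t0, t1,
    wirtinger_neg, hwB]
  -- Differentiating λ along n and F along T gives the same third-order terms, because ∂_l H_{jk} is
  -- symmetric in l and j. The remaining terms combine into multiples of the four kernel relations.
  rw [hwA 1 0, hwH 1 0 0, hwH 1 0 1]
  linear_combination
    (B 0 p * wirtinger 0 (A 1) p + B 1 p * wirtinger 1 (A 1) p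
      - A 1 p * H 0 0 p + A 0 p * H 1 0 p) * r0
    + (-B 0 p * wirtinger 0 (A 0) p - B 1 p * wirtinger 0 (A 1) p
      - A 1 p * H 0 1 p + A 0 p * H 1 1 p) * r1
    + 2 * (B 0 p * H 0 1 p + B 1 p * H 1 1 p) * s0
    - 2 * (B 0 p * H 0 0 p + B 1 p * H 1 0 p) * s1

end jet

section gradient

/-- Each ∂δ/∂z_j is half the conjugate of a gradient component. The resulting 2 is why the first
weight is 2u and not u. -/
theorem norm_gradient_eq {δ : CTwo → ℝ} {p : CTwo} (hδ : DifferentiableAt ℝ δ p) :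
    ‖∇ δ p‖ = 2 * delNorm δ p := by
  have h : ∀ v, inner ℝ (∇ δ p) v = fderiv ℝ δ p v := fun v => by
    rw [gradient, InnerProductSpace.toDual_symm_apply]
  have hj : ∀ j, wirtinger j (toComplexFun δ) p = conj ((∇ δ p) j) / 2 := by
    intro j
    rw [wirtinger, fderiv_toComplexFun hδ, fderiv_toComplexFun hδ, ← h, ← h]
    have i1 : inner ℝ (∇ δ p) (EuclideanSpace.single j (1 : ℂ)) = ((∇ δ p) j).re := by
      rw [PiLp.inner_apply]
      fin_cases j <;> simp [Fin.sum_univ_two, Complex.inner]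
    have i2 : inner ℝ (∇ δ p) (EuclideanSpace.single j Complex.I) = ((∇ δ p) j).im := by
      rw [PiLp.inner_apply]
      fin_cases j <;> simp [Fin.sum_univ_two, Complex.inner]
    rw [i1, i2]
    congr 1
    apply Complex.ext <;> simp
  rw [delNorm, hj, hj, EuclideanSpace.norm_eq, Fin.sum_univ_two]
  simp only [norm_div, Complex.norm_conj, div_pow]
  rw [show (2 : ℝ) = √4 by rw [show (4 : ℝ) = 2 ^ 2 by norm_num]; simp, ← Real.sqrt_mul (by norm_num)]
  congr 1
  simp
  ring

end gradient

/-! ### A smooth convex truncation. -/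

section convexTruncation

/-- A smooth convex nondecreasing function which is the identity on `[-κ, ∞)` and constant on
`(-∞, -2κ]`. -/
noncomputable def convexTrunc (κ t : ℝ) : ℝ :=
  -κ + ∫ x in (-κ)..t, Real.smoothTransition ((x + 2 * κ) / κ)

variable {κ : ℝ}

theorem continuous_convexTrunc_deriv (κ : ℝ) :
    Continuous fun x : ℝ => Real.smoothTransition ((x + 2 * κ) / κ) :=
  Real.smoothTransition.continuous.comp (by fun_prop)

theorem hasDerivAt_convexTrunc (κ t : ℝ) :
    HasDerivAt (convexTrunc κ) (Real.smoothTransition ((t + 2 * κ) / κ)) t :=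
  (intervalIntegral.integral_hasDerivAt_right
    ((continuous_convexTrunc_deriv κ).intervalIntegrable _ _)
    ((continuous_convexTrunc_deriv κ).stronglyMeasurableAtFilter _ _)
    (continuous_convexTrunc_deriv κ).continuousAt).const_add _

theorem deriv_convexTrunc (κ : ℝ) :
    deriv (convexTrunc κ) = fun t => Real.smoothTransition ((t + 2 * κ) / κ) :=
  funext fun t => (hasDerivAt_convexTrunc κ t).deriv

theorem contDiff_convexTrunc (κ : ℝ) : ContDiff ℝ ∞ (convexTrunc κ) := by
  rw [contDiff_infty_iff_deriv, deriv_convexTrunc]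
  exact ⟨fun t => (hasDerivAt_convexTrunc κ t).differentiableAt,
    Real.smoothTransition.contDiff.comp (by fun_prop)⟩

theorem deriv_convexTrunc_nonneg (κ t : ℝ) : 0 ≤ deriv (convexTrunc κ) t := by
  rw [deriv_convexTrunc]; exact Real.smoothTransition.nonneg _

theorem deriv_deriv_convexTrunc_nonneg (hκ : 0 < κ) (t : ℝ) :
    0 ≤ deriv (deriv (convexTrunc κ)) t := by
  rw [deriv_convexTrunc]
  refine Monotone.deriv_nonneg fun x y hxy => Real.smoothTransition.monotone ?_
  gcongr

theorem deriv_convexTrunc_eq_zero (hκ : 0 < κ) {t : ℝ} (ht : t ≤ -(2 * κ)) :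
    deriv (convexTrunc κ) t = 0 := by
  rw [deriv_convexTrunc]
  exact Real.smoothTransition.zero_of_nonpos (div_nonpos_of_nonpos_of_nonneg (by linarith) hκ.le)

theorem convexTrunc_eq_self (hκ : 0 < κ) {t : ℝ} (ht : -κ ≤ t) : convexTrunc κ t = t := by
  have : ∫ x in (-κ)..t, Real.smoothTransition ((x + 2 * κ) / κ) = ∫ x in (-κ)..t, (1 : ℝ) := by
    refine intervalIntegral.integral_congr fun x hx => ?_
    rw [Set.uIcc_of_le ht] at hx
    refine Real.smoothTransition.one_of_one_le ?_
    rw [le_div_iff₀ hκ]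
    linarith [hx.1]
  rw [convexTrunc, this]
  simp

theorem convexTrunc_neg (hκ : 0 < κ) {t : ℝ} (ht : t < 0) : convexTrunc κ t < 0 := by
  by_cases h : -κ ≤ t
  · rwa [convexTrunc_eq_self hκ h]
  · have hm : Monotone (convexTrunc κ) :=
      monotone_of_deriv_nonneg (fun t => (hasDerivAt_convexTrunc κ t).differentiableAt)
        (deriv_convexTrunc_nonneg κ)
    have := hm (not_le.1 h).le
    rw [convexTrunc_eq_self hκ le_rfl] at this
    linarith

end convexTruncation

/-! ### From a Hessian bound near the boundary to a Diederich–Fornæss exponent. -/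

section exponent

/-- The pointwise inequality expressing that `-(-r)^τ` has nonnegative complex Hessian. -/
def HessBound (τ : ℝ) (r : CTwo → ℝ) (p : CTwo) : Prop :=
  ∀ Z : CTwo, 0 ≤ (cHess (toComplexFun r) p Z Z).re
    + (1 - τ) / (-r p) * ‖cDeriv Z (toComplexFun r) p‖ ^ 2

theorem cHess_comp_self_re {f : CTwo → ℝ} {p : CTwo} {G : ℝ → ℝ} (hG : ContDiffAt ℝ 2 G (f p))
    (hf : ContDiffAt ℝ 2 f p) (Z : CTwo) :
    (cHess (toComplexFun fun q => G (f q)) p Z Z).re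
      = deriv (deriv G) (f p) * ‖cDeriv Z (toComplexFun f) p‖ ^ 2
        + deriv G (f p) * (cHess (toComplexFun f) p Z Z).re := by
  rw [cHess_comp hG hf, Complex.mul_conj']
  simp only [Complex.add_re, Complex.re_ofReal_mul]
  norm_cast

theorem hasDerivAt_neg_neg_rpow {τ x : ℝ} (hx : x < 0) :
    HasDerivAt (fun x : ℝ => -(-x) ^ τ) (τ * (-x) ^ (τ - 1)) x := by
  have := ((hasDerivAt_neg x).rpow_const (p := τ) (Or.inl (by linarith))).neg
  rw [show τ * (-x) ^ (τ - 1) = -(-1 * τ * (-x) ^ (τ - 1)) by ring]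
  exact this

theorem deriv_neg_neg_rpow {τ x : ℝ} (hx : x < 0) :
    deriv (fun x : ℝ => -(-x) ^ τ) x = τ * (-x) ^ (τ - 1) := (hasDerivAt_neg_neg_rpow hx).deriv

/-- Written as the first derivative times (1-τ)/(-x), so that the chain rule leaves a nonnegative
factor times the expression in `HessBound`. -/
theorem deriv_deriv_neg_neg_rpow {τ x : ℝ} (hx : x < 0) :
    deriv (deriv fun x : ℝ => -(-x) ^ τ) x = τ * (-x) ^ (τ - 1) * ((1 - τ) / (-x)) := by
  have h : deriv (fun x : ℝ => -(-x) ^ τ) =ᶠ[𝓝 x] fun x => τ * (-x) ^ (τ - 1) :=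
    (eventually_lt_nhds hx).mono fun y hy => deriv_neg_neg_rpow hy
  have hd : HasDerivAt (fun x : ℝ => τ * (-x) ^ (τ - 1)) (τ * (-1 * (τ - 1) * (-x) ^ (τ - 1 - 1)))
      x := ((hasDerivAt_neg x).rpow_const (p := τ - 1) (Or.inl (by linarith))).const_mul τ
  rw [h.deriv_eq, hd.deriv, Real.rpow_sub_one (by linarith) (τ - 1)]
  ring

theorem contDiffAt_neg_neg_rpow {τ x : ℝ} (hx : x < 0) {n : ℕ∞ω} :
    ContDiffAt ℝ n (fun x : ℝ => -(-x) ^ τ) x :=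
  (contDiffAt_id.neg.rpow_const_of_ne (by simpa using hx.ne)).neg

theorem HessBound.cHess_nonneg {τ : ℝ} {r : CTwo → ℝ} {p : CTwo} (h : HessBound τ r p)
    (hτ : 0 ≤ τ) (hr : ContDiffAt ℝ 2 r p) (hp : r p < 0) (Z : CTwo) :
    0 ≤ (cHess (toComplexFun fun q => -(-r q) ^ τ) p Z Z).re := by
  rw [cHess_comp_self_re (G := fun x : ℝ => -(-x) ^ τ) (contDiffAt_neg_neg_rpow hp) hr,
    deriv_deriv_neg_neg_rpow hp, deriv_neg_neg_rpow hp]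
  have h0 : 0 ≤ τ * (-r p) ^ (τ - 1) :=
    mul_nonneg hτ (Real.rpow_nonneg (by linarith) _)
  have := mul_nonneg h0 (h Z)
  linarith

/-- A compactness argument: a local condition at the boundary holds on a collar. -/
theorem exists_collar {Ω W : Set CTwo} (hbdd : Bornology.IsBounded Ω)
    {r : CTwo → ℝ} (hr : Continuous r) (hΩ : Ω = {p ∈ W | r p < 0})
    {P : CTwo → Prop} (hloc : ∀ q ∈ frontier Ω, ∀ᶠ p in 𝓝 q, p ∈ Ω → P p) :
    ∃ c > 0, ∀ p ∈ Ω, -c < r p → P p := by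
  have hcl : IsCompact (closure Ω) := hbdd.isCompact_closure
  set O : Set CTwo := interior {p | p ∈ Ω → P p} with hO
  have hfO : frontier Ω ⊆ O := fun q hq => mem_interior_iff_mem_nhds.2 (hloc q hq)
  have hK : IsCompact (closure Ω \ O) := hcl.diff isOpen_interior
  have hKΩ : ∀ p ∈ closure Ω \ O, r p < 0 := by
    intro p hp
    have : p ∈ interior Ω := by
      by_contra h
      exact hp.2 (hfO ⟨hp.1, h⟩)
    have := interior_subset this
    rw [hΩ] at this
    exact this.2
  -- What is left of the closure is compact and misses the boundary, so r has a negative maximum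
  -- there.
  obtain ⟨c, hc, hcK⟩ : ∃ c > 0, ∀ p ∈ closure Ω \ O, r p ≤ -c := by
    rcases (closure Ω \ O).eq_empty_or_nonempty with h | h
    · exact ⟨1, one_pos, by simp [h]⟩
    · obtain ⟨q, hq, hmax⟩ := hK.exists_isMaxOn h hr.continuousOn
      exact ⟨-r q, by linarith [hKΩ q hq], fun p hp => by simpa using hmax hp⟩
  refine ⟨c, hc, fun p hp hpc => ?_⟩
  by_cases hpO : p ∈ O
  · exact interior_subset hpO hp
  · linarith [hcK p ⟨subset_closure hp, hpO⟩]

/-- A defining function that satisfies the Hessian bound near the boundary yields a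
Diederich–Fornæss exponent. -/
theorem isDFExponent_of_hessBound {Ω W : Set CTwo} (hopen : IsOpen Ω)
    (hbdd : Bornology.IsBounded Ω) {τ : ℝ} (hτ0 : 0 < τ) (hτ1 : τ < 1) {r : CTwo → ℝ}
    (hr : ContDiff ℝ ∞ r) (hWo : IsOpen W) (hW : closure Ω ⊆ W) (hΩ : Ω = {p ∈ W | r p < 0})
    (hfr : frontier Ω = {p ∈ W | r p = 0}) (hgrad : ∀ p ∈ frontier Ω, ∇ r p ≠ 0)
    (hloc : ∀ q ∈ frontier Ω, ∀ᶠ p in 𝓝 q, p ∈ Ω → HessBound τ r p) : IsDFExponent Ω τ := by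
  obtain ⟨c, hc, hcr⟩ := exists_collar hbdd hr.continuous hΩ hloc
  -- With 2κ = c^τ, the set where -(-r)^τ > -2κ is exactly r > -c, so the truncation is locally
  -- active only inside the collar.
  set κ : ℝ := c ^ τ / 2 with hκdef
  have hκ : 0 < κ := by positivity
  set g : ℝ → ℝ := fun x => -(-x) ^ τ with hg
  have hgneg : ∀ x < 0, g x < 0 := fun x hx => by
    have : 0 < (-x) ^ τ := Real.rpow_pos_of_pos (by linarith) _
    simp only [hg]; linarith
  have hχneg : ∀ x < 0, 0 < -convexTrunc κ (g x) := fun x hx => by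
    linarith [convexTrunc_neg hκ (hgneg x hx)]
  classical
  -- Solves -(-ρ)^τ = χ(-(-r)^τ) for the truncation χ. Near the boundary χ is the identity, so ρ = r
  -- there and the gluing is smooth.
  set ρ : CTwo → ℝ := fun p =>
    if r p < 0 then -(-convexTrunc κ (g (r p))) ^ (1 / τ) else r p with hρ
  have hρneg : ∀ p, r p < 0 → ρ p < 0 := fun p hp => by
    have := Real.rpow_pos_of_pos (hχneg _ hp) (1 / τ)
    simp only [hρ, if_pos hp]; linarith
  have hρnn : ∀ p, ¬ r p < 0 → ρ p = r p := fun p hp => by simp only [hρ, if_neg hp]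
  have hnear : ∀ p, -κ ^ (1 / τ) < r p → ρ p = r p := by
    intro p hp
    by_cases h : r p < 0
    · have h1 : (-r p) ^ τ ≤ κ := by
        have : -r p ≤ κ ^ (1 / τ) := by linarith
        calc (-r p) ^ τ ≤ (κ ^ (1 / τ)) ^ τ :=
              Real.rpow_le_rpow (by linarith) this hτ0.le
          _ = κ := by rw [← Real.rpow_mul hκ.le, one_div_mul_cancel hτ0.ne', Real.rpow_one]
      have h2 : convexTrunc κ (g (r p)) = g (r p) :=
        convexTrunc_eq_self hκ (by simp only [hg]; linarith)
      simp only [hρ, if_pos h, h2]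
      simp only [hg, neg_neg]
      rw [← Real.rpow_mul (by linarith), mul_one_div_cancel hτ0.ne', Real.rpow_one, neg_neg]
    · exact hρnn p h
  have hnear_ev : ∀ p, 0 ≤ r p → ρ =ᶠ[𝓝 p] r := by
    intro p hp
    have hκ' : 0 < κ ^ (1 / τ) := by positivity
    filter_upwards [hr.continuous.continuousAt.eventually_const_lt
      (show -κ ^ (1 / τ) < r p by linarith)] with q hq
    exact hnear q hq
  have hχr : ∀ p, r p < 0 → ContDiffAt ℝ ∞ (fun q => convexTrunc κ (g (r q))) p := fun p hp =>
    (contDiff_convexTrunc κ).contDiffAt.comp p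
      ((contDiffAt_neg_neg_rpow hp).comp p hr.contDiffAt)
  have hρsmooth : ContDiff ℝ ∞ ρ := by
    rw [contDiff_iff_contDiffAt]
    intro p
    by_cases hp : r p < 0
    · have : ρ =ᶠ[𝓝 p] fun q => -(-convexTrunc κ (g (r q))) ^ (1 / τ) := by
        filter_upwards [hr.continuous.continuousAt.eventually_lt_const hp] with q hq
        simp only [hρ, if_pos hq]
      refine ContDiffAt.congr_of_eventuallyEq ?_ this
      exact ((hχr p hp).neg.rpow_const_of_ne (hχneg _ hp).ne').neg
    · exact hr.contDiffAt.congr_of_eventuallyEq (hnear_ev p (not_lt.1 hp))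
  refine ⟨hτ0, hτ1, ρ, ⟨W, hWo, hW, hρsmooth.contDiffOn, ?_, ?_, fun p hp => ?_⟩, ?_⟩
  · rw [hΩ]
    ext p
    refine and_congr_right fun _ => ⟨hρneg p, fun h => ?_⟩
    by_contra h'
    rw [hρnn p h'] at h
    exact h' h
  · rw [hfr]
    ext p
    refine and_congr_right fun _ => ⟨fun h => ?_, fun h => ?_⟩
    · rw [hρnn p (by rw [h]; simp), h]
    · by_cases h' : r p < 0
      · exact absurd h (hρneg p h').ne
      · rwa [hρnn p h'] at h
  · have h0 : r p = 0 := by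
      rw [hfr] at hp; exact hp.2
    rw [gradient, (hnear_ev p h0.ge).fderiv_eq]
    exact hgrad p hp
  · have hneg : ∀ p ∈ Ω, r p < 0 := fun p hp => by rw [hΩ] at hp; exact hp.2
    have hv : ∀ p ∈ Ω, -(-ρ p) ^ τ = convexTrunc κ (g (r p)) := fun p hp => by
      simp only [hρ, if_pos (hneg p hp), neg_neg]
      rw [← Real.rpow_mul (hχneg _ (hneg p hp)).le, one_div_mul_cancel hτ0.ne', Real.rpow_one,
        neg_neg]
    refine isPlurisubharmonicOn_of_cHess_nonneg hopen ?_ fun p hp Z => ?_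
    · exact (show ContDiffOn ℝ ∞ (fun q => convexTrunc κ (g (r q))) Ω from fun p hp =>
        (hχr p (hneg p hp)).contDiffWithinAt).congr hv
    · have hp0 := hneg p hp
      have hev : (toComplexFun fun p => -(-ρ p) ^ τ) =ᶠ[𝓝 p]
          toComplexFun fun q => convexTrunc κ (g (r q)) := by
        filter_upwards [hopen.mem_nhds hp] with q hq
        simp only [toComplexFun, hv q hq]
      have hr2 : ContDiffAt ℝ 2 r p := (hr.of_le two_le_infty).contDiffAt
      have hgr : ContDiffAt ℝ 2 (fun q => g (r q)) p := (contDiffAt_neg_neg_rpow hp0).comp p hr2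
      rw [cHess_congr hev, cHess_comp_self_re (f := fun q => g (r q))
        ((contDiff_convexTrunc κ).of_le two_le_infty).contDiffAt hgr]
      -- Convexity settles the gradient term. In the Hessian term either χ' = 0, or the point lies
      -- in the collar, where the bound holds.
      refine add_nonneg (mul_nonneg (deriv_deriv_convexTrunc_nonneg hκ _) (sq_nonneg _)) ?_
      by_cases hgp : g (r p) ≤ -(2 * κ)
      · rw [deriv_convexTrunc_eq_zero hκ hgp, zero_mul]
      · refine mul_nonneg (deriv_convexTrunc_nonneg κ _) ?_
        refine HessBound.cHess_nonneg (hcr p hp ?_) hτ0.le hr2 hp0 Z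
        simp only [hg, hκdef] at hgp
        have : (-r p) ^ τ < c ^ τ := by linarith [not_le.1 hgp]
        linarith [(Real.rpow_lt_rpow_iff (by linarith) hc.le hτ0).1 this]

end exponent

/-! ### Positivity of the quadratic form in the frame coefficients. -/

section quadratic

/-- Discriminant criterion: multiply by A and complete the square. -/
theorem quadratic_nonneg {A B : ℝ} {X : ℂ} (hA : 0 < A) (h : ‖X‖ ^ 2 ≤ A * B) (a t : ℂ) :
    0 ≤ A * ‖a‖ ^ 2 + 2 * (a * conj t * X).re + B * ‖t‖ ^ 2 := by
  have h1 : -(‖a‖ * ‖t‖ * ‖X‖) ≤ (a * conj t * X).re := by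
    have := Complex.abs_re_le_norm (a * conj t * X)
    rw [norm_mul, norm_mul, Complex.norm_conj] at this
    exact (abs_le.1 this).1
  have h2 : 0 ≤ A * (A * ‖a‖ ^ 2 - 2 * (‖a‖ * ‖t‖ * ‖X‖) + B * ‖t‖ ^ 2) := by
    nlinarith [sq_nonneg (A * ‖a‖ - ‖t‖ * ‖X‖), mul_le_mul_of_nonneg_right h (sq_nonneg ‖t‖)]
  have := nonneg_of_mul_nonneg_right h2 hA
  linarith

/-- The algebraic core: positivity of the form in the variables `a` and `t = b D / s`. -/
theorem frame_form_nonneg {s D lam hNN fLL fNN τ k : ℝ} {G fL fN fNL a b : ℂ} (hs : 0 < s)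
    (hD : 0 < D) (hk : -(k * s) ≤ lam) (hA : 0 < -k - τ * ‖fL‖ ^ 2 - fLL)
    (hX : ‖(conj G - s * conj fNL - τ * s * fL * conj fN) / D + τ * fL‖ ^ 2
      ≤ (-k - τ * ‖fL‖ ^ 2 - fLL) * (1 - τ + s * (hNN / D ^ 2 + 2 * τ * fN.re / D
        - τ * s * ‖fN‖ ^ 2 / D ^ 2 - s * fNN / D ^ 2))) :
    0 ≤ (lam * ‖a‖ ^ 2 + 2 * (a * conj b * conj G).re + hNN * ‖b‖ ^ 2)
      - s * (fLL * ‖a‖ ^ 2 + 2 * (a * conj b * conj fNL).re + fNN * ‖b‖ ^ 2)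
      + 2 * τ * D * (b * conj (a * fL + b * fN)).re - τ * s * ‖a * fL + b * fN‖ ^ 2
      + (1 - τ) / s * (D ^ 2 * ‖b‖ ^ 2) := by
  set t : ℂ := b * D / s with ht
  have hs' : (s : ℂ) ≠ 0 := by exact_mod_cast hs.ne'
  have hD' : (D : ℂ) ≠ 0 := by exact_mod_cast hD.ne'
  have hb : b = ((s / D : ℝ) : ℂ) * t := by rw [ht]; push_cast; field_simp
  have h := mul_nonneg hs.le (quadratic_nonneg hA hX a t)
  have h2 := mul_nonneg (show 0 ≤ lam + k * s by linarith) (sq_nonneg ‖a‖)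
  rw [show (conj G - s * conj fNL - τ * s * fL * conj fN) / D + τ * fL
    = ((1 / D : ℝ) : ℂ) * (conj G - s * conj fNL - τ * s * fL * conj fN) + τ * fL by
      push_cast; ring] at h
  clear_value t
  subst hb
  refine (add_nonneg h h2).trans_eq ?_
  simp only [Complex.sq_norm, Complex.normSq_apply, Complex.mul_re, Complex.mul_im,
    Complex.add_re, Complex.add_im, Complex.sub_re, Complex.sub_im, Complex.conj_re,
    Complex.conj_im, Complex.ofReal_re, Complex.ofReal_im]
  field_simp
  ring

end quadratic

/-! ### The Hessian bound for δ e^φ near a boundary point. -/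

section local_estimate

variable {δ φ : CTwo → ℝ} {p : CTwo}

theorem cHess_frame (hφ : ContDiffAt ℝ 2 φ p) (a b : ℂ) (L N : CTwo) :
    (cHess (toComplexFun φ) p (a • L + b • N) (a • L + b • N)).re
      = (cHess (toComplexFun φ) p L L).re * ‖a‖ ^ 2
        + 2 * (a * conj b * conj (cHess (toComplexFun φ) p N L)).re
        + (cHess (toComplexFun φ) p N N).re * ‖b‖ ^ 2 := by
  have hL := cHess_im hφ L
  have hN := cHess_im hφ N
  simp only [cHess_add_left, cHess_add_right, cHess_smul_left, cHess_smul_right]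
  rw [← cHess_conj hφ N L]
  simp only [Complex.sq_norm, Complex.normSq_apply, Complex.mul_re, Complex.mul_im,
    Complex.add_re, Complex.add_im, Complex.conj_re, Complex.conj_im, hL, hN]
  ring

theorem toComplexFun_mul (f g : CTwo → ℝ) :
    toComplexFun (fun q => f q * g q) = fun q => toComplexFun f q * toComplexFun g q := by
  ext q; simp [toComplexFun]

theorem cDeriv_mul_exp (hδ : DifferentiableAt ℝ δ p) (hφ : DifferentiableAt ℝ φ p) (Z : CTwo) :
    cDeriv Z (toComplexFun fun q => δ q * Real.exp (φ q)) p
      = Real.exp (φ p) * (cDeriv Z (toComplexFun δ) p + δ p * cDeriv Z (toComplexFun φ) p) := by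
  have he : DifferentiableAt ℝ (fun q => Real.exp (φ q)) p := hφ.exp
  rw [toComplexFun_mul, cDeriv_mul (differentiableAt_toComplexFun hδ)
    (differentiableAt_toComplexFun he), cDeriv_comp (Real.hasDerivAt_exp _) hφ]
  simp only [toComplexFun]
  ring

theorem cHess_mul_exp (hδ : ContDiffAt ℝ 2 δ p) (hφ : ContDiffAt ℝ 2 φ p) (Z Y : CTwo) :
    cHess (toComplexFun fun q => δ q * Real.exp (φ q)) p Z Y
      = Real.exp (φ p) * (cHess (toComplexFun δ) p Z Y
        + cDeriv Z (toComplexFun δ) p * conj (cDeriv Y (toComplexFun φ) p)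
        + cDeriv Z (toComplexFun φ) p * conj (cDeriv Y (toComplexFun δ) p)
        + δ p * (cHess (toComplexFun φ) p Z Y
          + cDeriv Z (toComplexFun φ) p * conj (cDeriv Y (toComplexFun φ) p))) := by
  have he : ContDiffAt ℝ 2 (fun q => Real.exp (φ q)) p := hφ.exp
  have dδ := hδ.differentiableAt (by norm_num)
  have dφ := hφ.differentiableAt (by norm_num)
  have de := he.differentiableAt (by norm_num)
  rw [toComplexFun_mul, cHess_mul (contDiffAt_toComplexFun hδ) (contDiffAt_toComplexFun he),
    cDerivBar_toComplexFun dδ, cDerivBar_toComplexFun de,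
    cHess_comp Real.contDiff_exp.contDiffAt hφ, cDeriv_comp (Real.hasDerivAt_exp _) dφ,
    cDeriv_comp (Real.hasDerivAt_exp _) dφ]
  simp only [toComplexFun, Real.deriv_exp, map_mul, Complex.conj_ofReal]
  ring

/-- The pointwise criterion for the Hessian bound of `δ e^φ`. -/
theorem hessBound_mul_exp {τ k : ℝ} (hδ : ContDiffAt ℝ 2 δ p) (hφ : ContDiffAt ℝ 2 φ p)
    (hs : 0 < -δ p) (hD : 0 < delSq δ p) (hk : k * δ p ≤ leviTan δ p)
    (hA : 0 < -k - τ * ‖cDeriv (tanField δ p) (toComplexFun φ) p‖ ^ 2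
      - (cHess (toComplexFun φ) p (tanField δ p) (tanField δ p)).re)
    (hX : ‖(conj (hessNorTan δ p)
          - ((-δ p : ℝ) : ℂ) * conj (cHess (toComplexFun φ) p (norField δ p) (tanField δ p))
          - τ * ((-δ p : ℝ) : ℂ) * cDeriv (tanField δ p) (toComplexFun φ) p
            * conj (cDeriv (norField δ p) (toComplexFun φ) p)) / (delSq δ p : ℂ)
        + τ * cDeriv (tanField δ p) (toComplexFun φ) p‖ ^ 2
      ≤ (-k - τ * ‖cDeriv (tanField δ p) (toComplexFun φ) p‖ ^ 2
          - (cHess (toComplexFun φ) p (tanField δ p) (tanField δ p)).re)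
        * (1 - τ + -δ p * ((cHess (toComplexFun δ) p (norField δ p) (norField δ p)).re
            / delSq δ p ^ 2
          + 2 * τ * (cDeriv (norField δ p) (toComplexFun φ) p).re / delSq δ p
          - τ * -δ p * ‖cDeriv (norField δ p) (toComplexFun φ) p‖ ^ 2 / delSq δ p ^ 2
          - -δ p * (cHess (toComplexFun φ) p (norField δ p) (norField δ p)).re
            / delSq δ p ^ 2))) :
    HessBound τ (fun q => δ q * Real.exp (φ q)) p := by
  intro Z
  have dδ := hδ.differentiableAt (by norm_num)
  have dφ := hφ.differentiableAt (by norm_num)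
  obtain ⟨a, b, rfl⟩ := frame_decomp dδ hD.ne' Z
  have key := frame_form_nonneg (a := a) (b := b) (lam := leviTan δ p) hs hD (by linarith)
    hA hX
  rw [cHess_mul_exp hδ hφ, cDeriv_mul_exp dδ dφ]
  have hcδ : cDeriv (a • tanField δ p + b • norField δ p) (toComplexFun δ) p
      = b * delSq δ p := by
    rw [cDeriv_add_vec, cDeriv_smul, cDeriv_smul, cDeriv_tanField, cDeriv_norField dδ]; ring
  have hcφ : cDeriv (a • tanField δ p + b • norField δ p) (toComplexFun φ) p
      = a * cDeriv (tanField δ p) (toComplexFun φ) p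
        + b * cDeriv (norField δ p) (toComplexFun φ) p := by
    rw [cDeriv_add_vec, cDeriv_smul, cDeriv_smul]
  have hHδ := cHess_frame hδ a b (tanField δ p) (norField δ p)
  have hHφ := cHess_frame hφ a b (tanField δ p) (norField δ p)
  change _ = leviTan δ p * ‖a‖ ^ 2 + 2 * (a * conj b * conj (hessNorTan δ p)).re + _ at hHδ
  rw [← hHδ, ← hHφ, ← hcφ] at key
  rw [hcδ]
  set Y := cDeriv (a • tanField δ p + b • norField δ p) (toComplexFun φ) p with hY
  set Hδ := cHess (toComplexFun δ) p (a • tanField δ p + b • norField δ p)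
    (a • tanField δ p + b • norField δ p)
  set Hφ := cHess (toComplexFun φ) p (a • tanField δ p + b • norField δ p)
    (a • tanField δ p + b • norField δ p)
  -- Every term carries one factor e^φ. Expanding (1-τ)|Zδ + δ Zφ|²/(-δ) removes all but a
  -- τ-fraction of the cross term and of the |Zφ|² term of Hess; hence the coefficients τ in `key`.
  refine (mul_nonneg (Real.exp_pos (φ p)).le key).trans_eq ?_
  have hs0 : δ p ≠ 0 := by linarith
  have he := (Real.exp_pos (φ p)).ne'
  clear_value Y Hδ Hφ
  simp only [Complex.sq_norm, Complex.normSq_apply, Complex.mul_re, Complex.mul_im,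
    Complex.add_re, Complex.add_im, Complex.conj_re,
    Complex.conj_im, Complex.ofReal_re, Complex.ofReal_im]
  field_simp
  ring

/-- The local version near a boundary point. -/
theorem eventually_hessBound {τ k : ℝ} {Ω : Set CTwo} (hδ : ContDiff ℝ ∞ δ)
    (hφ : ContDiff ℝ ∞ φ) (hneg : ∀ p ∈ Ω, δ p < 0) {q : CTwo} (hq : δ q = 0)
    (hD : 0 < delSq δ q) (hk : ∀ᶠ p in 𝓝 q, p ∈ Ω → k * δ p ≤ leviTan δ p)
    (hA : 0 < -k - τ * ‖cDeriv (tanField δ q) (toComplexFun φ) q‖ ^ 2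
      - (cHess (toComplexFun φ) q (tanField δ q) (tanField δ q)).re)
    (hX : ‖conj (hessNorTan δ q) / (delSq δ q : ℂ)
        + τ * cDeriv (tanField δ q) (toComplexFun φ) q‖ ^ 2
      < (-k - τ * ‖cDeriv (tanField δ q) (toComplexFun φ) q‖ ^ 2
          - (cHess (toComplexFun φ) q (tanField δ q) (tanField δ q)).re) * (1 - τ)) :
    ∀ᶠ p in 𝓝 q, p ∈ Ω → HessBound τ (fun q => δ q * Real.exp (φ q)) p := by
  have cδ := contDiff_toComplexFun hδ
  have cφ := contDiff_toComplexFun hφ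
  have kL := contDiff_tanField hδ
  have kN := contDiff_norField hδ
  have c0 : Continuous δ := hδ.continuous
  have c1 := (contDiff_delSq hδ).continuous
  have c2 := (contDiff_hessNorTan hδ).continuous
  have c3 := (contDiff_cDeriv cφ kL).continuous
  have c4 := (contDiff_cDeriv cφ kN).continuous
  have c5 := (contDiff_cHess cφ kL kL).continuous
  have c6 := (contDiff_cHess cφ kN kL).continuous
  have c7 := (contDiff_cHess cφ kN kN).continuous
  have c8 := (contDiff_cHess cδ kN kN).continuous
  have hD0 : delSq δ q ≠ 0 := hD.ne'
  have hD1 : (delSq δ q : ℂ) ≠ 0 := by exact_mod_cast hD0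
  have hD2 : delSq δ q ^ 2 ≠ 0 := pow_ne_zero 2 hD0
  have cA : Continuous fun p => -k - τ * ‖cDeriv (tanField δ p) (toComplexFun φ) p‖ ^ 2
      - (cHess (toComplexFun φ) p (tanField δ p) (tanField δ p)).re := by fun_prop
  have c1' : Continuous fun p => (delSq δ p : ℂ) := Complex.continuous_ofReal.comp c1
  have c0' : Continuous fun p => ((-δ p : ℝ) : ℂ) := Complex.continuous_ofReal.comp c0.neg
  have cX : ContinuousAt (fun p => ‖(conj (hessNorTan δ p)
          - ((-δ p : ℝ) : ℂ) * conj (cHess (toComplexFun φ) p (norField δ p) (tanField δ p))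
          - τ * ((-δ p : ℝ) : ℂ) * cDeriv (tanField δ p) (toComplexFun φ) p
            * conj (cDeriv (norField δ p) (toComplexFun φ) p)) / (delSq δ p : ℂ)
        + τ * cDeriv (tanField δ p) (toComplexFun φ) p‖ ^ 2) q := by
    refine ((ContinuousAt.div ?_ c1'.continuousAt hD1).add ?_).norm.pow 2
    · have e1 : Continuous fun p => conj (hessNorTan δ p) := Complex.continuous_conj.comp c2
      have e2 := Complex.continuous_conj.comp c6
      have e3 := Complex.continuous_conj.comp c4
      exact ((e1.sub (c0'.mul e2)).sub (((continuous_const.mul c0').mul c3).mul e3)).continuousAt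
    · exact (continuous_const.mul c3).continuousAt
  have cB : ContinuousAt (fun p => (1 - τ + -δ p *
        ((cHess (toComplexFun δ) p (norField δ p) (norField δ p)).re / delSq δ p ^ 2
          + 2 * τ * (cDeriv (norField δ p) (toComplexFun φ) p).re / delSq δ p
          - τ * -δ p * ‖cDeriv (norField δ p) (toComplexFun φ) p‖ ^ 2 / delSq δ p ^ 2
          - -δ p * (cHess (toComplexFun φ) p (norField δ p) (norField δ p)).re
            / delSq δ p ^ 2))) q := by
    have d1 := c1.continuousAt (x := q)
    have d2 : ContinuousAt (fun p => delSq δ p ^ 2) q := d1.pow 2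
    have e8 := (Complex.continuous_re.comp c8).continuousAt (x := q)
    have e4 := (continuous_const (y := 2 * τ)).mul (Complex.continuous_re.comp c4) |>.continuousAt
      (x := q)
    have e4' := ((continuous_const (y := τ)).mul c0.neg).mul (c4.norm.pow 2) |>.continuousAt
      (x := q)
    have e7 := (c0.neg.mul (Complex.continuous_re.comp c7)).continuousAt (x := q)
    exact continuousAt_const.add (c0.neg.continuousAt.mul
      ((((e8.div d2 hD2).add (e4.div d1 hD0)).sub (e4'.div d2 hD2)).sub (e7.div d2 hD2)))
  -- At q all corrections carry a factor δ and vanish, leaving the strict inequality `hX`, which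
  -- persists nearby by continuity.
  have hlt := cX.eventually_lt (cA.continuousAt.mul cB) (by
    simpa [hq] using hX)
  filter_upwards [hk, hlt, cA.continuousAt.eventually_const_lt hA,
    c1.continuousAt.eventually_const_lt hD] with p h1 h2 h3 h4 hp
  exact hessBound_mul_exp (hδ.of_le two_le_infty).contDiffAt (hφ.of_le two_le_infty).contDiffAt
    (by linarith [hneg p hp]) h4 (h1 hp) h3 h2.le

end local_estimate

/-! ### Propagating an inequality from the boundary inwards. -/

section monotone

/-- If `G ≥ 0` on the boundary and `G` decreases along a direction in which the defining function
increases, then `G ≥ 0` inside the domain near the boundary point. -/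
theorem eventually_nonneg_of_boundary {δ G : CTwo → ℝ} (hδ : ContDiff ℝ 1 δ) (hG : ContDiff ℝ 1 G)
    {W : Set CTwo} (hW : IsOpen W) {q ν : CTwo} (hqW : q ∈ W) (hq : δ q = 0)
    (hbd : ∀ p ∈ W, δ p = 0 → 0 ≤ G p) (hν : 0 < fderiv ℝ δ q ν) (hGν : fderiv ℝ G q ν < 0) :
    ∀ᶠ p in 𝓝 q, δ p < 0 → 0 ≤ G p := by
  have cδ : Continuous fun p => fderiv ℝ δ p ν := 
    (hδ.continuous_fderiv one_ne_zero).clm_apply continuous_const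
  have cG : Continuous fun p => fderiv ℝ G p ν := 
    (hG.continuous_fderiv one_ne_zero).clm_apply continuous_const
  set m := fderiv ℝ δ q ν / 2 with hm
  have hm0 : 0 < m := by positivity
  have hev : ∀ᶠ p in 𝓝 q, p ∈ W ∧ m < fderiv ℝ δ p ν ∧ fderiv ℝ G p ν < 0 :=
    (hW.eventually_mem hqW).and ((cδ.continuousAt.eventually_const_lt (by simp only [hm]; linarith)).and
      (cG.continuousAt.eventually_lt_const hGν))
  obtain ⟨R, hR, hball⟩ := Metric.eventually_nhds_iff_ball.1 hev
  -- Short enough that the segment from a point of the half-radius ball stays in the ball of radius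
  -- R; the +1 avoids a division by zero without using ν ≠ 0.
  set T := R / (2 * (‖ν‖ + 1)) with hT
  have hT0 : 0 < T := by positivity
  have hTν : T * ‖ν‖ ≤ R / 2 := by
    rw [hT, div_mul_eq_mul_div, div_le_div_iff₀ (by positivity) (by norm_num)]
    nlinarith [norm_nonneg ν]
  filter_upwards [Metric.ball_mem_nhds q (half_pos hR),
    hδ.continuous.continuousAt.eventually_const_lt (show -(m * T) < δ q by rw [hq]; nlinarith)]
    with p hp hpT hpn
  have hseg : ∀ t ∈ Set.Icc 0 T, p + t • ν ∈ Metric.ball q R := fun t ht => by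
    rw [Metric.mem_ball, dist_eq_norm] at hp ⊢
    calc ‖p + t • ν - q‖ = ‖(p - q) + t • ν‖ := by congr 1; abel
      _ ≤ ‖p - q‖ + ‖t • ν‖ := norm_add_le _ _
      _ ≤ ‖p - q‖ + T * ‖ν‖ := by
        rw [norm_smul, Real.norm_eq_abs, abs_of_nonneg ht.1]; gcongr; exact ht.2
      _ < R := by linarith
  have hline : ∀ t : ℝ, HasDerivAt (fun t : ℝ => p + t • ν) ν t := fun t => by
    simpa using ((hasDerivAt_id t).smul_const ν).const_add p
  have hdδ : ∀ t : ℝ, HasDerivAt (fun t : ℝ => δ (p + t • ν)) (fderiv ℝ δ (p + t • ν) ν) t :=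
    fun t => (hδ.differentiable one_ne_zero _).hasFDerivAt.comp_hasDerivAt t (hline t)
  have hdG : ∀ t : ℝ, HasDerivAt (fun t : ℝ => G (p + t • ν)) (fderiv ℝ G (p + t • ν) ν) t :=
    fun t => (hG.differentiable one_ne_zero _).hasFDerivAt.comp_hasDerivAt t (hline t)
  -- Along the segment δ grows at rate at least m and starts above -mT, so it reaches 0 by time T.
  -- At that boundary point G ≥ 0, and G has only decreased on the way.
  have hTend : 0 ≤ δ (p + T • ν) := by
    have hmono : MonotoneOn (fun t : ℝ => δ (p + t • ν) - m * t) (Set.Icc 0 T) := by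
      refine monotoneOn_of_hasDerivWithinAt_nonneg (convex_Icc 0 T)
        (f' := fun t => fderiv ℝ δ (p + t • ν) ν - m * 1)
        (fun t _ => (((hdδ t).sub ((hasDerivAt_id t).const_mul m))).continuousAt.continuousWithinAt)
        (fun t _ => ((hdδ t).sub ((hasDerivAt_id t).const_mul m)).hasDerivWithinAt) fun t ht => ?_
      have := (hball _ (hseg t (interior_subset ht))).2.1
      linarith
    have := hmono ⟨le_rfl, hT0.le⟩ ⟨hT0.le, le_rfl⟩ hT0.le
    simp only [zero_smul, add_zero, mul_zero, sub_zero] at this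
    linarith
  obtain ⟨t, ht, ht0⟩ : ∃ t ∈ Set.Icc 0 T, δ (p + t • ν) = 0 := by
    have := intermediate_value_Icc hT0.le (f := fun t : ℝ => δ (p + t • ν))
      (fun t _ => (hdδ t).continuousAt.continuousWithinAt)
    obtain ⟨t, ht, h⟩ := this (show (0 : ℝ) ∈ _ by simpa using ⟨hpn.le, hTend⟩)
    exact ⟨t, ht, h⟩
  have hanti : AntitoneOn (fun t : ℝ => G (p + t • ν)) (Set.Icc 0 T) :=
    antitoneOn_of_hasDerivWithinAt_nonpos (convex_Icc 0 T)
      (fun t _ => (hdG t).continuousAt.continuousWithinAt)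
      (fun t _ => (hdG t).hasDerivWithinAt)
      fun t ht => (hball _ (hseg t (interior_subset ht))).2.2.le
  have h1 := hanti ⟨le_rfl, hT0.le⟩ ht ht.1
  have h2 := hbd _ (hball _ (hseg t ht)).1 ht0
  simp only [zero_smul, add_zero] at h1
  linarith

end monotone

/-! ### The complex Hessian of |z|² is the identity. -/

section normSq

theorem contDiff_coord (k : Fin 2) : ContDiff ℝ ∞ fun q : CTwo => q k :=
  ((EuclideanSpace.proj k : CTwo →L[ℂ] ℂ).restrictScalars ℝ).contDiff

theorem fderiv_coord (k : Fin 2) (p v : CTwo) : fderiv ℝ (fun q : CTwo => q k) p v = v k := by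
  have : HasFDerivAt (fun q : CTwo => q k)
      ((EuclideanSpace.proj k : CTwo →L[ℂ] ℂ).restrictScalars ℝ) p :=
    ((EuclideanSpace.proj k : CTwo →L[ℂ] ℂ).restrictScalars ℝ).hasFDerivAt
  rw [this.fderiv]; rfl

theorem wirtinger_coord (j k : Fin 2) :
    wirtinger j (fun q : CTwo => q k) = fun _ => if k = j then 1 else 0 := by
  ext p
  simp only [wirtinger, fderiv_coord]
  by_cases h : k = j <;> simp [h]

theorem wirtingerBar_coord (j k : Fin 2) :
    wirtingerBar j (fun q : CTwo => q k) = fun _ => 0 := by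
  ext p
  simp only [wirtingerBar, fderiv_coord]
  by_cases h : k = j <;> simp [h]

theorem wirtingerBar_conj_coord (j k : Fin 2) :
    wirtingerBar j (fun q : CTwo => conj (q k)) = fun _ => if k = j then 1 else 0 := by
  ext p
  rw [wirtingerBar_conj ((contDiff_coord k).differentiable (by simp) p), wirtinger_coord]
  split_ifs <;> simp

theorem toComplexFun_norm_sq : (toComplexFun fun q => ‖q‖ ^ 2)
    = fun q => q 0 * conj (q 0) + q 1 * conj (q 1) := by
  ext q
  simp only [toComplexFun]
  rw [EuclideanSpace.norm_sq_eq, Fin.sum_univ_two, Complex.mul_conj', Complex.mul_conj']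
  push_cast; rfl

theorem cHess_norm_sq (p a : CTwo) :
    cHess (toComplexFun fun q => ‖q‖ ^ 2) p a a = ((‖a 0‖ ^ 2 + ‖a 1‖ ^ 2 : ℝ) : ℂ) := by
  have h2 : ∀ k, ContDiffAt ℝ 2 (fun q : CTwo => q k) p := fun k =>
    ((contDiff_coord k).of_le two_le_infty).contDiffAt
  have h2' : ∀ k, ContDiffAt ℝ 2 (fun q : CTwo => conj (q k)) p := fun k =>
    ((contDiff_conj (contDiff_coord k)).of_le two_le_infty).contDiffAt
  have hd : ∀ k, DifferentiableAt ℝ (fun q : CTwo => q k) p := fun k =>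
    (h2 k).differentiableAt (by norm_num)
  have key : ∀ k, cHess (fun q : CTwo => q k * conj (q k)) p a a = a k * conj (a k) := by
    intro k
    rw [cHess_mul (h2 k) (h2' k), cDerivBar_conj (hd k), cDeriv_conj (hd k)]
    simp only [cHess, wirtingerBar_coord, wirtingerBar_conj_coord, wirtinger_const, cDeriv,
      cDerivBar, wirtinger_coord]
    fin_cases k <;> simp
  rw [toComplexFun_norm_sq, cHess_add ((h2 0).mul (h2' 0)) ((h2 1).mul (h2' 1)), key, key,
    Complex.mul_conj', Complex.mul_conj']
  push_cast; rfl

end normSq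

/-! ### Change of the boundary data under δ ↦ δ e^φ. -/

section rescale

variable {δ φ : CTwo → ℝ} {p : CTwo}

theorem wirtinger_mul_exp_of_zero (hδ : DifferentiableAt ℝ δ p) (hφ : DifferentiableAt ℝ φ p)
    (h0 : δ p = 0) (j : Fin 2) :
    wirtinger j (toComplexFun fun q => δ q * Real.exp (φ q)) p
      = Real.exp (φ p) * wirtinger j (toComplexFun δ) p := by
  have he : DifferentiableAt ℝ (fun q => Real.exp (φ q)) p := hφ.exp
  rw [toComplexFun_mul, wirtinger_mul (differentiableAt_toComplexFun hδ)
    (differentiableAt_toComplexFun he)]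
  simp [toComplexFun, h0]

theorem delSq_mul_exp_of_zero (hδ : DifferentiableAt ℝ δ p) (hφ : DifferentiableAt ℝ φ p)
    (h0 : δ p = 0) :
    delSq (fun q => δ q * Real.exp (φ q)) p = Real.exp (φ p) ^ 2 * delSq δ p := by
  simp only [delSq, wirtinger_mul_exp_of_zero hδ hφ h0, norm_mul, Complex.norm_real,
    Real.norm_eq_abs, abs_of_pos (Real.exp_pos _)]
  ring

theorem tanField_mul_exp_of_zero (hδ : DifferentiableAt ℝ δ p) (hφ : DifferentiableAt ℝ φ p)
    (h0 : δ p = 0) :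
    tanField (fun q => δ q * Real.exp (φ q)) p = (Real.exp (φ p) : ℂ) • tanField δ p := by
  ext k
  fin_cases k <;> simp [tanField, wirtinger_mul_exp_of_zero hδ hφ h0]

theorem norField_mul_exp_of_zero (hδ : DifferentiableAt ℝ δ p) (hφ : DifferentiableAt ℝ φ p)
    (h0 : δ p = 0) :
    norField (fun q => δ q * Real.exp (φ q)) p = (Real.exp (φ p) : ℂ) • norField δ p := by
  have hd : DifferentiableAt ℝ (fun q => δ q * Real.exp (φ q)) p := hδ.mul hφ.exp
  have h : ∀ j, wirtingerBar j (toComplexFun fun q => δ q * Real.exp (φ q)) p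
      = Real.exp (φ p) * wirtingerBar j (toComplexFun δ) p := fun j => by
    rw [wirtingerBar_toComplexFun hd, wirtinger_mul_exp_of_zero hδ hφ h0, map_mul,
      Complex.conj_ofReal, wirtingerBar_toComplexFun hδ]
  ext k
  fin_cases k <;> simp only [norField, h] <;> simp

/-- Two of the three exponentials come from the rescaled field, one from the function. The cross
terms contain Tδ = 0. -/
theorem leviTan_mul_exp_of_zero (hδ : ContDiffAt ℝ 2 δ p) (hφ : ContDiffAt ℝ 2 φ p)
    (h0 : δ p = 0) :
    leviTan (fun q => δ q * Real.exp (φ q)) p = Real.exp (φ p) ^ 3 * leviTan δ p := by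
  have dδ := hδ.differentiableAt (by norm_num)
  have dφ := hφ.differentiableAt (by norm_num)
  rw [leviTan, tanField_mul_exp_of_zero dδ dφ h0, cHess_mul_exp hδ hφ, cDeriv_smul,
    cDeriv_tanField, cHess_smul_left, cHess_smul_right, ← leviTan_ofReal hδ, h0]
  simp only [Complex.conj_ofReal, map_zero, mul_zero, zero_mul, add_zero, Complex.ofReal_zero]
  norm_cast
  ring

/-- Of the two cross terms only (nδ)·conj(Tφ) survives, and nδ = D. This is how a weight can cancel
the mixed Hessian. -/
theorem hessNorTan_mul_exp_of_zero (hδ : ContDiffAt ℝ 2 δ p) (hφ : ContDiffAt ℝ 2 φ p)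
    (h0 : δ p = 0) :
    hessNorTan (fun q => δ q * Real.exp (φ q)) p = (Real.exp (φ p) : ℂ) ^ 3
      * (hessNorTan δ p + delSq δ p * conj (cDeriv (tanField δ p) (toComplexFun φ) p)) := by
  have dδ := hδ.differentiableAt (by norm_num)
  have dφ := hφ.differentiableAt (by norm_num)
  rw [hessNorTan, tanField_mul_exp_of_zero dδ dφ h0, norField_mul_exp_of_zero dδ dφ h0,
    cHess_mul_exp hδ hφ, cDeriv_smul, cDeriv_smul, cDeriv_smul, cDeriv_smul, cDeriv_tanField,
    cDeriv_norField dδ, cHess_smul_left, cHess_smul_right, h0, hessNorTan]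
  simp only [map_mul, Complex.conj_ofReal, map_zero, mul_zero, zero_mul, add_zero,
    Complex.ofReal_zero]
  ring

end rescale

/-! ### The weight that compensates the loss of Levi positivity. -/

section weight

/-- The weight `-ε|z|² - M|Hess_δ(N, L)|²`. -/
noncomputable def flatWeight (δ : CTwo → ℝ) (ε M : ℝ) (p : CTwo) : ℝ :=
  -ε * ‖p‖ ^ 2 + -M * ‖hessNorTan δ p‖ ^ 2

variable {δ : CTwo → ℝ} {ε M : ℝ}

theorem contDiff_flatWeight (hδ : ContDiff ℝ ∞ δ) : ContDiff ℝ ∞ (flatWeight δ ε M) :=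
  (contDiff_const.mul (contDiff_norm_sq ℝ)).add
    (contDiff_const.mul ((contDiff_hessNorTan hδ).norm_sq ℝ))

theorem toComplexFun_flatWeight : toComplexFun (flatWeight δ ε M)
    = fun q => ((-ε : ℝ) : ℂ) * toComplexFun (fun q => ‖q‖ ^ 2) q
      + ((-M : ℝ) : ℂ) * (hessNorTan δ q * conj (hessNorTan δ q)) := by
  ext q
  rw [Complex.mul_conj']
  simp [toComplexFun, flatWeight]

/-- |F|² vanishes to second order where F = 0, so M is invisible to first derivatives and can be
taken large after ε is fixed. -/
theorem cDeriv_flatWeight (hδ : ContDiff ℝ ∞ δ) {p : CTwo} (hp : hessNorTan δ p = 0) (a : CTwo) :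
    cDeriv a (toComplexFun (flatWeight δ ε M)) p
      = ((-ε : ℝ) : ℂ) * cDeriv a (toComplexFun fun q => ‖q‖ ^ 2) p := by
  have h1 : DifferentiableAt ℝ (toComplexFun fun q : CTwo => ‖q‖ ^ 2) p :=
    (contDiff_toComplexFun (contDiff_norm_sq ℝ (n := 1))).differentiable one_ne_zero p
  have h2 : DifferentiableAt ℝ (hessNorTan δ) p :=
    (contDiff_hessNorTan hδ).differentiable (by simp) p
  have h3 : DifferentiableAt ℝ (fun q => conj (hessNorTan δ q)) p :=
    (contDiff_conj (contDiff_hessNorTan hδ)).differentiable (by simp) p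
  rw [toComplexFun_flatWeight, cDeriv_add (h1.const_mul _) ((h2.fun_mul h3).const_mul _),
    cDeriv_const_mul h1, cDeriv_const_mul (h2.fun_mul h3), cDeriv_mul h2 h3, hp]
  simp

theorem cHess_flatWeight (hδ : ContDiff ℝ ∞ δ) {p : CTwo} (hp : hessNorTan δ p = 0) (a : CTwo) :
    (cHess (toComplexFun (flatWeight δ ε M)) p a a).re
      = -ε * (‖a 0‖ ^ 2 + ‖a 1‖ ^ 2)
        - M * (‖cDeriv a (hessNorTan δ) p‖ ^ 2 + ‖cDerivBar a (hessNorTan δ) p‖ ^ 2) := by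
  have h1 : ContDiffAt ℝ 2 (toComplexFun fun q : CTwo => ‖q‖ ^ 2) p :=
    (contDiff_toComplexFun (contDiff_norm_sq ℝ)).contDiffAt
  have h2 : ContDiffAt ℝ 2 (hessNorTan δ) p :=
    ((contDiff_hessNorTan hδ).of_le two_le_infty).contDiffAt
  have h3 : ContDiffAt ℝ 2 (fun q => conj (hessNorTan δ q)) p :=
    ((contDiff_conj (contDiff_hessNorTan hδ)).of_le two_le_infty).contDiffAt
  have hd := h2.differentiableAt (by norm_num)
  rw [toComplexFun_flatWeight, cHess_add (contDiffAt_const.mul h1)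
    (contDiffAt_const.mul (h2.mul h3)), cHess_const_mul h1, cHess_const_mul (h2.mul h3),
    cHess_mul h2 h3, cHess_norm_sq, cDerivBar_conj hd, cDeriv_conj hd, hp, map_zero,
    Complex.mul_conj', mul_comm (conj _), Complex.mul_conj']
  simp only [zero_mul, zero_add, Complex.add_re, Complex.re_ofReal_mul, Complex.ofReal_re]
  norm_cast
  ring

theorem norm_sq_tanField (δ : CTwo → ℝ) (p : CTwo) :
    ‖tanField δ p 0‖ ^ 2 + ‖tanField δ p 1‖ ^ 2 = delSq δ p := by
  simp [tanField, delSq]; ring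

end weight

/-! ### Choice of constants and conclusion. -/

/-- If the mixed Hessian vanishes on the Levi-flat set, then all `τ ∈ (0, 1)` are
Diederich–Fornæss exponents. -/
theorem isDFExponent_of_hessNorTan_eq_zero {Ω W : Set CTwo} (hopen : IsOpen Ω)
    (hbdd : Bornology.IsBounded Ω) {δ : CTwo → ℝ} (hδ : ContDiff ℝ ∞ δ) (hWo : IsOpen W)
    (hW : closure Ω ⊆ W) (hΩ : Ω = {p ∈ W | δ p < 0}) (hfr : frontier Ω = {p ∈ W | δ p = 0})
    (hD : ∀ p ∈ frontier Ω, 0 < delSq δ p) (hlevi : ∀ p ∈ frontier Ω, 0 ≤ leviTan δ p)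
    (hflat : ∀ p ∈ frontier Ω, leviTan δ p = 0 → hessNorTan δ p = 0) {τ : ℝ} (hτ0 : 0 < τ)
    (hτ1 : τ < 1) : IsDFExponent Ω τ := by
  have hcpt : IsCompact (frontier Ω) :=
    hbdd.isCompact_closure.of_isClosed_subset isClosed_frontier frontier_subset_closure
  have hN2 : ContDiff ℝ ∞ fun q : CTwo => ‖q‖ ^ 2 := contDiff_norm_sq ℝ
  obtain ⟨m, hm, hmD⟩ : ∃ m > 0, ∀ p ∈ frontier Ω, m ≤ delSq δ p := by
    rcases (frontier Ω).eq_empty_or_nonempty with h | h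
    · exact ⟨1, one_pos, by simp [h]⟩
    · obtain ⟨q, hq, hmin⟩ := hcpt.exists_isMinOn h (contDiff_delSq hδ).continuous.continuousOn
      exact ⟨delSq δ q, hD q hq, fun p hp => hmin hp⟩
  obtain ⟨C, hC0, hC⟩ : ∃ C : ℝ, 0 ≤ C ∧ ∀ p ∈ frontier Ω,
      ‖cDeriv (tanField δ p) (toComplexFun fun q => ‖q‖ ^ 2) p‖ ^ 2 ≤ C := by
    have hc := (contDiff_cDeriv (contDiff_toComplexFun hN2) (contDiff_tanField hδ)).continuous
    obtain ⟨C, hC⟩ := hcpt.exists_bound_of_continuousOn hc.continuousOn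
    exact ⟨C ^ 2, sq_nonneg C, fun p hp => by gcongr; exact hC p hp⟩
  have hτ : 0 < 1 - τ := by linarith
  -- Makes |Tφ|² ≤ ε²C at most a quarter of εm(1-τ) on Σ.
  set ε : ℝ := m * (1 - τ) / (4 * (C + 1)) with hε
  have hε0 : 0 < ε := by positivity
  have hεC : ε * C ≤ m * (1 - τ) / 4 := by
    have : ε * (C + 1) = m * (1 - τ) / 4 := by rw [hε]; field_simp
    nlinarith
  -- The value for which M|y|² + εm/4 - |y|/m is a perfect square over εm³.
  set M : ℝ := 1 / (ε * m ^ 3) with hM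
  set φ := flatWeight δ ε M with hφdef
  have hφ : ContDiff ℝ ∞ φ := contDiff_flatWeight hδ
  have hneg : ∀ p ∈ Ω, δ p < 0 := fun p hp => by rw [hΩ] at hp; exact hp.2
  have hzero : ∀ p ∈ frontier Ω, δ p = 0 := fun p hp => by rw [hfr] at hp; exact hp.2
  have hr : ContDiff ℝ ∞ fun q => δ q * Real.exp (φ q) := hδ.mul hφ.exp
  refine isDFExponent_of_hessBound (W := W) hopen hbdd hτ0 hτ1 hr hWo hW ?_ ?_ ?_ ?_
  · rw [hΩ]
    ext p
    simp [mul_neg_iff, Real.exp_pos, (Real.exp_pos _).not_gt]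
  · rw [hfr]
    ext p
    simp
  · intro p hp h
    have h1 := norm_gradient_eq (hr.differentiable (by simp) p)
    rw [h, norm_zero] at h1
    have h2 : delNorm (fun q => δ q * Real.exp (φ q)) p = √(delSq _ p) := rfl
    rw [h2, delSq_mul_exp_of_zero (hδ.differentiable (by simp) p)
      (hφ.differentiable (by simp) p) (hzero p hp)] at h1
    have := Real.sqrt_pos.2 (mul_pos (pow_pos (Real.exp_pos (φ p)) 2) (hD p hp))
    linarith
  · intro q hq
    have hqW : q ∈ W := hW (frontier_subset_closure hq)
    set fL := cDeriv (tanField δ q) (toComplexFun φ) q with hfL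
    set fLL := (cHess (toComplexFun φ) q (tanField δ q) (tanField δ q)).re with hfLL
    by_cases hq0 : leviTan δ q = 0
    · have hG := hflat q hq hq0
      have hDq := hD q hq
      have hmq := hmD q hq
      set x := cDeriv (tanField δ q) (toComplexFun fun q => ‖q‖ ^ 2) q with hx
      set y := cDeriv (tanField δ q) (hessNorTan δ) q with hy
      have hfL' : ‖fL‖ ^ 2 = ε ^ 2 * ‖x‖ ^ 2 := by
        rw [hfL, hφdef, cDeriv_flatWeight hδ hG, norm_mul, Complex.norm_real, norm_neg,
          Real.norm_eq_abs, abs_of_pos hε0, mul_pow]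
      have hfLL' : fLL ≤ -ε * m - M * ‖y‖ ^ 2 := by
        rw [hfLL, hφdef, cHess_flatWeight hδ hG, norm_sq_tanField]
        have : 0 ≤ M * ‖cDerivBar (tanField δ q) (hessNorTan δ) q‖ ^ 2 := by positivity
        nlinarith
      have hfLb : ‖fL‖ ^ 2 ≤ ε * m * (1 - τ) / 4 := by
        rw [hfL']
        have := hC q hq
        calc ε ^ 2 * ‖x‖ ^ 2 ≤ ε ^ 2 * C := by gcongr
          _ = ε * (ε * C) := by ring
          _ ≤ ε * (m * (1 - τ) / 4) := by gcongr
          _ = _ := by ring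
      have hyb : y.re / delSq δ q ≤ M * ‖y‖ ^ 2 + ε * m / 4 := by
        have h1 : y.re / delSq δ q ≤ ‖y‖ / m :=
          div_le_div₀ (norm_nonneg _) (Complex.re_le_norm y) hm hmq
        have h2 : M * ‖y‖ ^ 2 + ε * m / 4 - ‖y‖ / m
            = (‖y‖ - ε * m ^ 2 / 2) ^ 2 / (ε * m ^ 3) := by
          rw [hM]; field_simp; ring
        have h3 : 0 ≤ (‖y‖ - ε * m ^ 2 / 2) ^ 2 / (ε * m ^ 3) := by positivity
        linarith
      have hεm : 0 < ε * m := by positivity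
      -- The margin εm/8 makes the normal derivative of λ - kδ strictly negative. Of the gain εm,
      -- the parts εm/4 (AM-GM), εm/8 (margin) and εm/4 (τ|Tφ|²) are spent, which leaves the 3εm/8
      -- of `hA`.
      set k := y.re / delSq δ q + ε * m / 8 with hk
      have hτf : τ * ‖fL‖ ^ 2 ≤ ε * m / 4 := by
        nlinarith [sq_nonneg ‖fL‖]
      have hA : 3 * (ε * m) / 8 ≤ -k - τ * ‖fL‖ ^ 2 - fLL := by
        rw [hk]; linarith
      refine eventually_hessBound (k := k) hδ hφ hneg (hzero q hq) hDq ?_ (by linarith) ?_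
      · have hδ1 : ContDiff ℝ 1 δ := hδ.of_le (by norm_num)
        have hl1 : ContDiff ℝ 1 (leviTan δ) := (contDiff_leviTan hδ).of_le (by norm_num)
        have dδ := hδ1.differentiable one_ne_zero q
        have dl := hl1.differentiable one_ne_zero q
        have e1 : fderiv ℝ δ q (norField δ q) = 2 * delSq δ q := by
          rw [fderiv_eq_two_re dδ, cDeriv_norField dδ, Complex.ofReal_re]
        have e2 : fderiv ℝ (leviTan δ) q (norField δ q) = 2 * y.re := by
          rw [fderiv_eq_two_re dl, cDeriv_norField_leviTan hδ hDq.ne' hq0 hG]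
        have e3 : fderiv ℝ (fun p => leviTan δ p - k * δ p) q (norField δ q)
            = 2 * y.re - k * (2 * delSq δ q) := by
          rw [fderiv_fun_sub dl (dδ.const_mul k), fderiv_const_mul dδ]
          simp [e1, e2]
        have := eventually_nonneg_of_boundary (G := fun p => leviTan δ p - k * δ p)
          (ν := norField δ q) hδ1
          (hl1.sub (contDiff_const.mul hδ1)) hWo hqW (hzero q hq) (fun p hpW hp => by
            have : p ∈ frontier Ω := by rw [hfr]; exact ⟨hpW, hp⟩
            simpa [hp] using hlevi p this) (by rw [e1]; positivity) (by
            rw [e3, hk, add_mul, div_mul_eq_mul_div]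
            have : y.re * (2 * delSq δ q) / delSq δ q = 2 * y.re := by field_simp
            rw [this]
            have : 0 < ε * m / 8 * (2 * delSq δ q) := by positivity
            linarith)
        filter_upwards [this] with p hp hpΩ
        linarith [hp (hneg p hpΩ)]
      · rw [hG, map_zero, zero_div, zero_add, norm_mul, Complex.norm_real, Real.norm_eq_abs,
          abs_of_pos hτ0, mul_pow]
        have h1 : τ ^ 2 * ‖fL‖ ^ 2 ≤ ‖fL‖ ^ 2 :=
          mul_le_of_le_one_left (sq_nonneg _) (by nlinarith)
        have h2 := mul_le_mul_of_nonneg_right hA hτ.le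
        have h3 : 0 < ε * m * (1 - τ) := by positivity
        linarith
    · have hpos : 0 < leviTan δ q := lt_of_le_of_ne (hlevi q hq) (Ne.symm hq0)
      set X := conj (hessNorTan δ q) / (delSq δ q : ℂ) + τ * fL with hX
      -- Here λ > 0 = kδ at q, so every real k is admissible near q; this one makes the discriminant
      -- inequality hold with room 1-τ.
      set k := -(τ * ‖fL‖ ^ 2 + fLL + (‖X‖ ^ 2 / (1 - τ) + 1)) with hk
      have hkA : -k - τ * ‖fL‖ ^ 2 - fLL = ‖X‖ ^ 2 / (1 - τ) + 1 := by rw [hk]; ring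
      refine eventually_hessBound (k := k) hδ hφ hneg (hzero q hq) (hD q hq) ?_ ?_ ?_
      · have hc : Continuous fun p => leviTan δ p - k * δ p :=
          (contDiff_leviTan hδ).continuous.sub (continuous_const.mul hδ.continuous)
        filter_upwards [hc.continuousAt.eventually_const_lt
          (show 0 < leviTan δ q - k * δ q by rw [hzero q hq]; linarith)] with p hp _
        linarith
      · rw [← hfL, ← hfLL, hkA]; positivity
      · rw [← hfL, ← hfLL, hkA, ← hX, add_mul, div_mul_cancel₀ _ hτ.ne']
        linarith

/-- Let `Ω ⊂ ℂ²` be a bounded pseudoconvex domain with smooth boundary and `δ` any defining function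
of it. If there is a real function `u`, smooth on a neighbourhood of the Levi-flat set `Σ`, with
`L u = - Hess_δ(L, N) / ‖∇δ‖` on `Σ`, then the Diederich–Fornæss index of `Ω` is `1`. -/
theorem proposition1p5 (Ω : Set CTwo) (hopen : IsOpen Ω) (hconn : IsConnected Ω)
    (hbdd : Bornology.IsBounded Ω) (δ : CTwo → ℝ) (hδ : IsDefiningFunction Ω δ)
    (hpsc : IsLeviPseudoconvex Ω δ)
    (hu : ∃ (u : CTwo → ℝ) (V : Set CTwo), IsOpen V ∧ leviFlatSet Ω δ ⊆ V ∧ ContDiffOn ℝ ∞ u V ∧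
      ∀ p ∈ leviFlatSet Ω δ,
        holDeriv (tangentL δ p) u p
          = -complexHess δ p (tangentL δ p) (normalN δ p) / (‖∇ δ p‖ : ℂ)) :
    dfIndex Ω = 1 := by
  obtain ⟨U, hU, hclU, hδU, hΩU, hfrU, hgrad⟩ := hδ
  obtain ⟨u, V, hV, hSV, huV, hueq⟩ := hu
  have hcl : IsCompact (closure Ω) := hbdd.isCompact_closure
  have hcpt : IsCompact (frontier Ω) :=
    hcl.of_isClosed_subset isClosed_frontier frontier_subset_closure
  obtain ⟨g, hg, W, hW, hclW, hWU, hgW⟩ := exists_contDiff_eventuallyEq hU hcl hclU hδU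
  have hΩW : Ω = {p ∈ W | g p < 0} := by
    ext p
    refine ⟨fun hp => ⟨hclW (subset_closure hp), ?_⟩, fun hp => ?_⟩
    · rw [hgW p (hclW (subset_closure hp))]
      rw [hΩU] at hp; exact hp.2
    · rw [hΩU]; exact ⟨hWU hp.1, by rw [← hgW p hp.1]; exact hp.2⟩
  have hfrW : frontier Ω = {p ∈ W | g p = 0} := by
    ext p
    refine ⟨fun hp => ⟨hclW (frontier_subset_closure hp), ?_⟩, fun hp => ?_⟩
    · rw [hgW p (hclW (frontier_subset_closure hp))]
      rw [hfrU] at hp; exact hp.2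
    · rw [hfrU]; exact ⟨hWU hp.1, by rw [← hgW p hp.1]; exact hp.2⟩
  have h2 : ∀ p, ContDiffAt ℝ 2 g p := fun p => (hg.of_le two_le_infty).contDiffAt
  have hd : ∀ p, DifferentiableAt ℝ g p := fun p => hg.differentiable (by simp) p
  have hev : ∀ p ∈ frontier Ω, δ =ᶠ[𝓝 p] g := fun p hp => by
    filter_upwards [hW.mem_nhds (hclW (frontier_subset_closure hp))] with q hq
    exact (hgW q hq).symm
  have hevc : ∀ p ∈ frontier Ω, toComplexFun δ =ᶠ[𝓝 p] toComplexFun g := fun p hp =>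
    (hev p hp).mono fun q hq => by simp only [toComplexFun, hq]
  have hnorm : ∀ p ∈ frontier Ω, ‖∇ δ p‖ = 2 * √(delSq g p) := fun p hp => by
    rw [gradient, (hev p hp).fderiv_eq]
    exact norm_gradient_eq (hd p)
  have hDpos : ∀ p ∈ frontier Ω, 0 < √(delSq g p) := fun p hp => by
    have := norm_pos_iff.2 (hgrad p hp)
    rw [hnorm p hp] at this
    linarith
  have hdel : ∀ p ∈ frontier Ω, delNorm δ p = √(delSq g p) := fun p hp => by
    simp only [delNorm, delSq, wirtinger_congr (hevc p hp)]
  have hL : ∀ p ∈ frontier Ω, tangentL δ p = (((√(delSq g p))⁻¹ : ℝ) : ℂ) • tanField g p :=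
    fun p hp => by
    rw [tangentL, hdel p hp]
    ext k
    fin_cases k <;> simp [tanField, wirtinger_congr (hevc p hp)]
  have hN : ∀ p ∈ frontier Ω, normalN δ p = (((√(delSq g p))⁻¹ : ℝ) : ℂ) • norField g p :=
    fun p hp => by
    rw [normalN, hdel p hp]
    ext k
    fin_cases k <;> simp [norField, wirtingerBar_congr (hevc p hp)]
  have hlevi : ∀ p ∈ frontier Ω, leviForm δ p = (√(delSq g p))⁻¹ ^ 2 * leviTan g p := by
    intro p hp
    rw [leviForm, complexHess_eq_cHess, cHess_congr (hevc p hp), hL p hp, cHess_smul_left,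
      cHess_smul_right, ← leviTan_ofReal (h2 p), Complex.conj_ofReal]
    norm_cast
    ring
  have hlevi_nonneg : ∀ p ∈ frontier Ω, 0 ≤ leviTan g p := fun p hp => by
    have h := hpsc p hp
    rw [hlevi p hp] at h
    exact nonneg_of_mul_nonneg_right h (pow_pos (inv_pos.2 (hDpos p hp)) 2)
  have hS : leviFlatSet Ω δ = {p ∈ frontier Ω | leviTan g p = 0} := by
    ext p
    refine and_congr_right fun hp => ?_
    rw [hlevi p hp, mul_eq_zero, or_iff_right (pow_pos (inv_pos.2 (hDpos p hp)) 2).ne']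
  have hSc : IsCompact (leviFlatSet Ω δ) := by
    rw [hS]
    exact hcpt.inter_right (isClosed_eq (contDiff_leviTan hg).continuous continuous_const)
  obtain ⟨v, hv, W', hW', hSW', -, hvW'⟩ := exists_contDiff_eventuallyEq hV hSc hSV huV
  -- The hypothesis on u with the normalizations cleared: L and n carry 1/√D and ‖∇δ‖ = 2√D, so it
  -- reads 2D·Tu = -conj F, and conjugation gives the claim.
  have hflat : ∀ p ∈ frontier Ω, leviTan g p = 0 →
      hessNorTan g p + delSq g p * conj (cDeriv (tanField g p) (toComplexFun fun q => 2 * v q) p)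
        = 0 := by
    intro p hp hp0
    have hpS : p ∈ leviFlatSet Ω δ := by rw [hS]; exact ⟨hp, hp0⟩
    have h := hueq p hpS
    have huv : toComplexFun u =ᶠ[𝓝 p] toComplexFun v := by
      filter_upwards [hW'.mem_nhds (hSW' hpS)] with q hq
      simp only [toComplexFun, hvW' q hq]
    have e2 : cDeriv (tanField g p) (toComplexFun fun q => 2 * v q) p
        = 2 * cDeriv (tanField g p) (toComplexFun v) p := by
      rw [cDeriv_comp (G := fun x => 2 * x) (by simpa using (hasDerivAt_id (v p)).const_mul 2)
        (hv.differentiable (by simp) p)]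
      norm_num
    rw [holDeriv_eq_cDeriv, cDeriv_congr huv, complexHess_eq_cHess, cHess_congr (hevc p hp),
      hL p hp, hN p hp, cDeriv_smul, cHess_smul_left, cHess_smul_right, hnorm p hp,
      ← hessNorTan_conj (h2 p), Complex.conj_ofReal] at h
    have hs : ((√(delSq g p) : ℝ) : ℂ) ≠ 0 := by exact_mod_cast (hDpos p hp).ne'
    have hsq : (delSq g p : ℂ) = ((√(delSq g p) : ℝ) : ℂ) ^ 2 := by
      rw [← Complex.ofReal_pow, Real.sq_sqrt (delSq_nonneg g p)]
    rw [e2, hsq]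
    set s := ((√(delSq g p) : ℝ) : ℂ) with hsdef
    have hsc : conj s = s := Complex.conj_ofReal _
    push_cast at h
    rw [← hsdef] at h
    field_simp at h
    have h' := congrArg conj h
    simp only [map_mul, map_pow, map_neg, Complex.conj_conj, hsc, map_ofNat] at h' ⊢
    linear_combination h'
  have key : ∀ τ, 0 < τ → τ < 1 → IsDFExponent Ω τ := by
    intro τ hτ0 hτ1
    have h2v : ContDiff ℝ ∞ fun q => 2 * v q := contDiff_const.mul hv
    have h2v2 : ∀ p, ContDiffAt ℝ 2 (fun q => 2 * v q) p := fun p =>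
      (h2v.of_le two_le_infty).contDiffAt
    have hzero : ∀ p ∈ frontier Ω, g p = 0 := fun p hp => by rw [hfrW] at hp; exact hp.2
    refine isDFExponent_of_hessNorTan_eq_zero (W := W)
      (δ := fun q => g q * Real.exp (2 * v q)) hopen hbdd (hg.mul h2v.exp) hW hclW ?_ ?_
      (fun p hp => ?_) (fun p hp => ?_) (fun p hp hp0 => ?_) hτ0 hτ1
    · rw [hΩW]
      ext p
      simp [mul_neg_iff, Real.exp_pos, (Real.exp_pos _).not_gt]
    · rw [hfrW]
      ext p
      simp
    · rw [delSq_mul_exp_of_zero (φ := fun q => 2 * v q) (hd p)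
        (h2v.differentiable (by simp) p) (hzero p hp)]
      exact mul_pos (pow_pos (Real.exp_pos _) 2) (Real.sqrt_pos.1 (hDpos p hp))
    · rw [leviTan_mul_exp_of_zero (φ := fun q => 2 * v q) (h2 p) (h2v2 p) (hzero p hp)]
      exact mul_nonneg (pow_pos (Real.exp_pos _) 3).le (hlevi_nonneg p hp)
    · rw [leviTan_mul_exp_of_zero (φ := fun q => 2 * v q) (h2 p) (h2v2 p) (hzero p hp),
        mul_eq_zero, or_iff_right (pow_pos (Real.exp_pos _) 3).ne'] at hp0
      rw [hessNorTan_mul_exp_of_zero (φ := fun q => 2 * v q) (h2 p) (h2v2 p) (hzero p hp),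
        hflat p hp hp0, mul_zero]
  have hset : {τ : ℝ | IsDFExponent Ω τ} = Set.Ioo 0 1 :=
    Set.ext fun τ => ⟨fun h => ⟨h.1, h.2.1⟩, fun h => key τ h.1 h.2⟩
  rw [dfIndex, hset, csSup_Ioo zero_lt_one]
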